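/- **Setting.** Let $X,U,Y,Z$ be complex Banach spaces. *Plant.* $A$ generates a strongly continuous semigroup on $X$; for a fixed $\lambda_0\in\rho(A)$ let $X_1=(D(A),\|(\lambda_0-A)\cdot\|)$, let $X_{-1}$ be the completion of $X$ in the norm $\|(\lambda_0-A)^{-1}\cdot\|$, and let $A_{-1}:X\to X_{-1}$ be the continuous extension of $A$. Let $B\in\mathcal L(U,X_{-1})$ and $D\in\mathcal L(U,Y)$, and let $C:D(C)\subset X\to Y$ be linear with $D(A)\subset D(C)$ and $C|_{D(A)}\in\mathcal L(X_1,Y)$, such that $\operatorname{ran}((\lambda-A_{-1})^{-1}B)\subset D(C)$ and $C(\lambda-A_{-1})^{-1}B\in\mathcal L(U,Y)$ for $\lambda\in\rho(A)$. *Exosystem.* Let $I$ be a countable index set ($I=\mathbb Z$, or finite for a finite-dimensional exosystem), $\omega_k\in\mathbb R$ and $n_k\ge 1$ for $k\in I$, with $\sup_k n_k<\infty$, and let $W$ be a Hilbert space with orthonormal basis $\{\phi_k^l: k\in I,\ 1\le l\le n_k\}$. Put $P_k=\sum_l\langle\cdot,\phi_k^l\rangle\phi_k^l$, $S_k=\sum_{l}\langle\cdot,\phi_k^l\rangle(i\omega_k\phi_k^l+\phi_k^{l-1})$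 with $\phi_k^0:=0$, and $Sv=\sum_kS_kv$ on $D(S)=\{v:\sum_k\|S_kv\|^2<\infty\}$. $S$ generates the group $T_S(t)v=\sum_ke^{i\omega_kt}\sum_{l}\langle v,\phi_k^l\rangle\sum_{j\le l}\frac{t^{l-j}}{(l-j)!}\phi_k^j$. For $\alpha\ge0$ let $W_\alpha=\{v:\|v\|_\alpha^2=\sum_k(1+\omega_k^2)^\alpha\|P_kv\|^2<\infty\}$. Let $E\in\mathcal L(W,X)$, $F\in\mathcal L(W,Y)$. *Controller.* $\mathcal G_1$ generates a strongly continuous semigroup on $Z$, $\mathcal G_2\in\mathcal L(Y,Z)$, and $K\in\mathcal L(Z_1,U)$, where $Z_1$ is $D(\mathcal G_1)$ with the graph norm. *Closed loop.* On $X_e=X\times Z$ let $A_e(x,z)=(A_{-1}x+BKz,\ \mathcal G_2Cx+(\mathcal G_1+\mathcal G_2DK)z)$ with domain $\{(x,z)\in D(C)\times D(\mathcal G_1): A_{-1}x+BKz\in X\}$, $B_ev=(Ev,\mathcal G_2Fv)$, $C_e(x,z)=Cx+DKz$ on $D(C)\times D(\mathcal G_1)$, $D_e=F$. If $A_e$ generates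 $T_e(t)$, the state is $x_e(t)=T_e(t)x_{e0}+\int_0^tT_e(t-s)B_eT_S(s)v_0\,ds$ and the regulation error is $e(t)=C_ex_e(t)+D_eT_S(t)v_0$. A solution $\Sigma\in\mathcal L(W_\alpha,X_e)$ of the Sylvester equation $\Sigma S=A_e\Sigma+B_e$ is one with $\Sigma(W_{\alpha+1})\subset D(A_e)$ for which the equation holds on $W_{\alpha+1}$. *Perturbations.* $\mathcal O$ is the class of all $(\tilde A,\tilde B,\tilde C,\tilde D,\tilde E,\tilde F)$ satisfying the above assumptions on the plant and on $E,F$ (with the same spaces $X,U,Y,W$), such that $i\omega_k\in\rho(\tilde A)$ for all $k$, the closed-loop operator $\tilde A_e$ with the same controller generates a strongly stable semigroup, $\tilde C_e$ is $\tilde A_e$-bounded, and $\Sigma S=\tilde A_e\Sigma+\tilde B_e$ has a solution $\Sigma\in\mathcal L(W_\alpha,X_e)$. *Robust output regulation.* The controller *solves the robust output regulation problem on $W_\alpha$* if (a) $A_e$ generates a strongly stable semigroup; (b) $e(t)\to0$ as $t\to\infty$ for all $x_{e0}\in D(A_e)$, $v_0\in W_{\alpha+1}$; (c) for every perturbation in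 $\mathcal O$ the error of the perturbed closed loop tends to $0$ for all $x_{e0}\in D(\tilde A_e)$, $v_0\in W_{\alpha+1}$. *Internal model.* If $\dim Y<\infty$, the controller *incorporates a p-copy internal model* if for all $k$ we have $\dim\ker(i\omega_k-\mathcal G_1)\ge\dim Y$ and $\mathcal G_1$ has at least $\dim Y$ independent Jordan chains of length at least $n_k$ at $i\omega_k$. **Theorem.** Let $\alpha\ge0$. Assume that $\dim Y<\infty$, that $i\omega_k\in\rho(A)$ for all $k$, that $A_e$ generates a strongly stable semigroup and $C_e$ is $A_e$-bounded, that $i\omega_k\in\rho(A_e)$ for all $k$, and that the Sylvester equation $\Sigma S=A_e\Sigma+B_e$ has a solution $\Sigma\in\mathcal L(W_\alpha,X_e)$. Then the controller solves the robust output regulation problem on $W_\alpha$ if and only if it incorporates a p-copy internal model of the exosystem. -/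

import Mathlib

open Filter Topology

noncomputable section

namespace IMP

/-! ### Unbounded operators, resolvents and strongly continuous semigroups -/

section Operators

variable {H : Type*} [NormedAddCommGroup H] [NormedSpace ℂ H]
variable {V : Type*} [NormedAddCommGroup V] [NormedSpace ℂ V]

/-- `R` is a bounded two-sided inverse of `l - A : D(A) → H`. -/
def IsResolvent (A : H →ₗ.[ℂ] H) (l : ℂ) (R : H →L[ℂ] H) : Prop :=
  (∀ x : H, ∃ h : R x ∈ A.domain, l • R x - A ⟨R x, h⟩ = x) ∧
    ∀ x : A.domain, R (l • (x : H) - A x) = x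

/-- The resolvent set `ρ(A)`. -/
def resolventSet (A : H →ₗ.[ℂ] H) : Set ℂ := {l | ∃ R : H →L[ℂ] H, IsResolvent A l R}

open Classical in
/-- The resolvent operator `R(l, A) = (l - A)⁻¹` for `l ∈ ρ(A)` (and `0` for other `l`). -/
def resolvent (A : H →ₗ.[ℂ] H) (l : ℂ) : H →L[ℂ] H :=
  if h : ∃ R : H →L[ℂ] H, IsResolvent A l R then h.choose else 0

theorem isResolvent_resolvent {A : H →ₗ.[ℂ] H} {l : ℂ} (h : l ∈ resolventSet A) :
    IsResolvent A l (resolvent A l) := by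
  have h' : ∃ R : H →L[ℂ] H, IsResolvent A l R := h
  rw [resolvent, dif_pos h']
  exact h'.choose_spec

/-- The kernel of `l - A`. -/
def eigenspace (A : H →ₗ.[ℂ] H) (l : ℂ) : Submodule ℂ H :=
  (LinearMap.ker (l • A.domain.subtype - A.toFun)).map A.domain.subtype

/-- `C` is defined on `D(A)` and bounded there in the graph norm of `A`. The graph norm is equivalent
to the norm `‖(l - A) x‖` for every `l ∈ ρ(A)`, so this says that `C` restricts to a bounded operator
on the scale space of `A` of index one. -/
def RelBounded (C : H →ₗ.[ℂ] V) (A : H →ₗ.[ℂ] H) : Prop :=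
  ∃ h : A.domain ≤ C.domain, ∃ M : ℝ, ∀ x : A.domain,
    ‖C ⟨x, h x.2⟩‖ ≤ M * (‖(x : H)‖ + ‖A x‖)

/-- `T(t)`, `t ≥ 0`, is a strongly continuous semigroup (the values at `t < 0` play no role). -/
structure IsC0Semigroup (T : ℝ → H →L[ℂ] H) : Prop where
  zero : T 0 = 1
  add : ∀ s t : ℝ, 0 ≤ s → 0 ≤ t → T (s + t) = T s * T t
  cont : ∀ x : H, ContinuousOn (fun t => T t x) (Set.Ici 0)

/-- `A`, with exactly its given domain, is the generator of the strongly continuous semigroup `T`. -/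
def Generates (A : H →ₗ.[ℂ] H) (T : ℝ → H →L[ℂ] H) : Prop :=
  IsC0Semigroup T ∧ ∀ x y : H, (x, y) ∈ A.graph ↔
    Tendsto (fun h : ℝ => (h : ℂ)⁻¹ • (T h x - x)) (𝓝[>] 0) (𝓝 y)

/-- Strong stability of a semigroup. -/
def StronglyStable (T : ℝ → H →L[ℂ] H) : Prop :=
  ∀ x : H, Tendsto (fun t => T t x) atTop (𝓝 0)

/-- `A` generates a strongly stable strongly continuous semigroup. -/
def GeneratesStronglyStable (A : H →ₗ.[ℂ] H) : Prop :=
  ∃ T : ℝ → H →L[ℂ] H, Generates A T ∧ StronglyStable T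

end Operators

/-! ### The extrapolation space -/

section Extrapolation

variable {X : Type*} [NormedAddCommGroup X] [NormedSpace ℂ X]

/-- The space `X` with the norm `‖R x‖`. -/
def PreExtrap (_R : X →L[ℂ] X) : Type _ := X

instance (R : X →L[ℂ] X) : AddCommGroup (PreExtrap R) := inferInstanceAs (AddCommGroup X)

instance (R : X →L[ℂ] X) : Module ℂ (PreExtrap R) := inferInstanceAs (Module ℂ X)

/-- `R`, as a linear map on `X` with the new norm. -/
def PreExtrap.toBase (R : X →L[ℂ] X) : PreExtrap R →ₗ[ℂ] X := R.toLinearMap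

instance (R : X →L[ℂ] X) : SeminormedAddCommGroup (PreExtrap R) :=
  SeminormedAddCommGroup.induced (PreExtrap R) X (PreExtrap.toBase R)

instance (R : X →L[ℂ] X) : NormedSpace ℂ (PreExtrap R) :=
  NormedSpace.induced ℂ (PreExtrap R) X (PreExtrap.toBase R)

/-- The completion of `X` in the norm `‖R x‖`. For `R = R(l₀, A)` this is the space `X₋₁`. -/
abbrev Extrap (R : X →L[ℂ] X) : Type _ := UniformSpace.Completion (PreExtrap R)

/-- The canonical map from `X` to the completion. -/
def toExtrap (R : X →L[ℂ] X) : X →ₗ[ℂ] Extrap R :=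
  (UniformSpace.Completion.toComplL (𝕜 := ℂ) (E := PreExtrap R)).toLinearMap ∘ₗ
    (LinearMap.id : X →ₗ[ℂ] X)

theorem norm_toExtrap (R : X →L[ℂ] X) (x : X) : ‖toExtrap R x‖ = ‖R x‖ :=
  UniformSpace.Completion.norm_coe (E := PreExtrap R) x

theorem toExtrap_injective {A : X →ₗ.[ℂ] X} {l : ℂ} (h : l ∈ resolventSet A) {x : X}
    (hx : toExtrap (resolvent A l) x = 0) : x = 0 := by
  obtain ⟨hd, h1⟩ := (isResolvent_resolvent h).1 x
  have h0 : resolvent A l x = 0 := by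
    rw [← norm_eq_zero, ← norm_toExtrap, hx, norm_zero]
  have h2 : A ⟨resolvent A l x, hd⟩ = 0 := by
    rw [show (⟨resolvent A l x, hd⟩ : A.domain) = 0 from Subtype.ext h0, LinearPMap.map_zero]
  rw [← h1, h2, h0]
  simp

/-- The operator `A₋₁ : X → X₋₁`: the continuous extension to `X` of the densely defined operator
`A : D(A) ⊆ X → X ⊆ X₋₁`, which is bounded from the norm of `X` to that of `X₋₁`. -/
def extrapOp (A : X →ₗ.[ℂ] X) (l : ℂ) : X →L[ℂ] Extrap (resolvent A l) :=
  (toExtrap (resolvent A l) ∘ₗ A.toFun).extendOfNorm A.domain.subtype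

/-- The operator `A₋₁` extends `A`. -/
theorem extrapOp_apply {A : X →ₗ.[ℂ] X} {l : ℂ} (hd : Dense (A.domain : Set X))
    (h : l ∈ resolventSet A) (x : A.domain) :
    extrapOp A l (x : X) = toExtrap (resolvent A l) (A x) := by
  refine LinearMap.extendOfNorm_eq (e := A.domain.subtype)
    (f := toExtrap (resolvent A l) ∘ₗ A.toFun) ?_ ?_ x
  · simpa [DenseRange] using hd
  · refine ⟨‖l‖ * ‖resolvent A l‖ + 1, fun y => ?_⟩
    have h1 := (isResolvent_resolvent h).2 y
    have h2 : resolvent A l (A y) = l • resolvent A l (y : X) - y := by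
      rw [map_sub, map_smul] at h1
      rw [eq_sub_iff_add_eq, add_comm, ← eq_sub_iff_add_eq]; exact h1.symm
    have h3 : ‖(toExtrap (resolvent A l) ∘ₗ A.toFun) y‖ = ‖resolvent A l (A y)‖ :=
      norm_toExtrap _ _
    rw [h3, h2]
    calc ‖l • resolvent A l (y : X) - y‖ ≤ ‖l • resolvent A l (y : X)‖ + ‖(y : X)‖ := norm_sub_le _ _
      _ ≤ ‖l‖ * (‖resolvent A l‖ * ‖(y : X)‖) + ‖(y : X)‖ := by
          rw [norm_smul]; gcongr; exact (resolvent A l).le_opNorm _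
      _ = (‖l‖ * ‖resolvent A l‖ + 1) * ‖A.domain.subtype y‖ := by
          rw [Submodule.subtype_apply]; ring

end Extrapolation

/-! ### The exosystem -/

/-- A block diagonal exosystem on the Hilbert space `W`, with frequencies `ω k`, sizes `n k ≥ 1` of the
Jordan blocks that are uniformly bounded, and an orthonormal basis `φ ⟨k, l⟩`, `l = 0, …, n k - 1`.
(The second index is shifted by one: `φ ⟨k, 0⟩` is the eigenvector of the block `k`.) -/
structure Exosystem (ι W : Type*) [NormedAddCommGroup W] [InnerProductSpace ℂ W] where
  ω : ι → ℝ
  n : ι → ℕ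
  n_pos : ∀ k, 0 < n k
  n_bdd : ∃ N : ℕ, ∀ k, n k ≤ N
  φ : HilbertBasis (Σ k, Fin (n k)) ℂ W

namespace Exosystem

variable {ι W : Type*} [NormedAddCommGroup W] [InnerProductSpace ℂ W] (exo : Exosystem ι W)

/-- The frequency `iω_k` as a complex number. -/
def freq (k : ι) : ℂ := Complex.I * (exo.ω k : ℂ)

/-- The coefficient `⟨v, φ_k^l⟩`, linear in `v`. -/
def coeff (k : ι) (l : Fin (exo.n k)) : W →ₗ[ℂ] ℂ := (innerSL ℂ (exo.φ ⟨k, l⟩)).toLinearMap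

/-- The vector `φ_k^{l-1}`, and `0` if `φ_k^l` is the first vector of the block. -/
def prev (k : ι) (l : Fin (exo.n k)) : W :=
  if (l : ℕ) = 0 then 0 else exo.φ ⟨k, ⟨(l : ℕ) - 1, lt_of_le_of_lt (Nat.sub_le _ _) l.2⟩⟩

/-- The orthogonal projection `P_k`. -/
def proj (k : ι) : W →ₗ[ℂ] W :=
  ∑ l : Fin (exo.n k), (exo.coeff k l).smulRight (exo.φ ⟨k, l⟩)

/-- The Jordan block `S_k`. -/
def block (k : ι) : W →ₗ[ℂ] W :=
  ∑ l : Fin (exo.n k),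
    (exo.coeff k l).smulRight (exo.freq k • exo.φ ⟨k, l⟩ + exo.prev k l)

/-- The vectors `v` with `∑ c_k ‖L_k v‖² < ∞`. -/
def sqSummable {ι W : Type*} [NormedAddCommGroup W] [InnerProductSpace ℂ W]
    (c : ι → ℝ) (hc : ∀ k, 0 ≤ c k) (L : ι → W →ₗ[ℂ] W) : Submodule ℂ W where
  carrier := {v | Summable fun k => c k * ‖L k v‖ ^ 2}
  zero_mem' := by simp [summable_zero]
  add_mem' := by
    intro v w hv hw
    refine Summable.of_nonneg_of_le (fun k => mul_nonneg (hc k) (sq_nonneg _)) (fun k => ?_)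
      ((hv.add hw).mul_left 2)
    have h1 : ‖L k (v + w)‖ ≤ ‖L k v‖ + ‖L k w‖ := by rw [map_add]; exact norm_add_le _ _
    have h2 : ‖L k (v + w)‖ ^ 2 ≤ 2 * (‖L k v‖ ^ 2 + ‖L k w‖ ^ 2) := by
      nlinarith [norm_nonneg (L k (v + w)), norm_nonneg (L k v), norm_nonneg (L k w),
        sq_nonneg (‖L k v‖ - ‖L k w‖)]
    nlinarith [hc k, mul_le_mul_of_nonneg_left h2 (hc k)]
  smul_mem' := by
    intro a v hv
    have : (fun k => c k * ‖L k (a • v)‖ ^ 2) = fun k => ‖a‖ ^ 2 * (c k * ‖L k v‖ ^ 2) := by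
      funext k
      rw [map_smul, norm_smul]; ring
    change Summable _
    rw [this]
    exact Summable.mul_left _ hv

/-- The scale space `W_α`. -/
def scale (α : ℝ) : Submodule ℂ W :=
  sqSummable (fun k => (1 + exo.ω k ^ 2) ^ α) (fun _ => by positivity) exo.proj

/-- The norm `‖·‖_α` of `W_α`. -/
def scaleNorm (α : ℝ) (v : W) : ℝ :=
  Real.sqrt (∑' k, (1 + exo.ω k ^ 2) ^ α * ‖exo.proj k v‖ ^ 2)

theorem inner_block_block {k m : ι} (hkm : k ≠ m) (v w : W) :
    inner ℂ (exo.block k v) (exo.block m w) = 0 := by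
  have hb : ∀ (a : Fin (exo.n k)) (b : Fin (exo.n m)),
      inner ℂ (exo.φ ⟨k, a⟩) (exo.φ ⟨m, b⟩) = 0 := fun a b =>
    exo.φ.orthonormal.2 fun h => hkm (congrArg Sigma.fst h)
  have hp : ∀ (a : Fin (exo.n k)) (b : Fin (exo.n m)),
      inner ℂ (exo.freq k • exo.φ ⟨k, a⟩ + exo.prev k a)
        (exo.freq m • exo.φ ⟨m, b⟩ + exo.prev m b) = 0 := by
    intro a b
    unfold prev
    split_ifs <;> simp [hb]
  simp only [block, LinearMap.sum_apply, LinearMap.smulRight_apply, sum_inner, inner_sum,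
    inner_smul_left, inner_smul_right, hp]
  simp

theorem summable_block [CompleteSpace W] {v : W}
    (hv : Summable fun k => (1 : ℝ) * ‖exo.block k v‖ ^ 2) :
    Summable fun k => exo.block k v := by
  let G : ι → Submodule ℂ W := fun k => LinearMap.range (exo.block k)
  have hG : OrthogonalFamily ℂ (fun k => G k) fun k => (G k).subtypeₗᵢ := by
    rintro k m hkm ⟨_, a, rfl⟩ ⟨_, b, rfl⟩
    exact exo.inner_block_block hkm a b
  have := (hG.summable_iff_norm_sq_summable (fun k => ⟨exo.block k v, v, rfl⟩)).2
    (by simpa using hv)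
  simpa using this

/-- The operator `S v = ∑ S_k v` with domain the `v` such that `∑ ‖S_k v‖² < ∞`. -/
def S [CompleteSpace W] : W →ₗ.[ℂ] W where
  domain := sqSummable (fun _ => 1) (fun _ => zero_le_one) exo.block
  toFun :=
    { toFun := fun v => ∑' k, exo.block k (v : W)
      map_add' := fun v w => by
        simp only [Submodule.coe_add, map_add]
        exact (exo.summable_block v.2).tsum_add (exo.summable_block w.2)
      map_smul' := fun a v => by
        simp only [Submodule.coe_smul, map_smul, RingHom.id_apply]
        exact (exo.summable_block v.2).tsum_const_smul a }

/-- The group `T_S(t)` generated by `S`. -/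
def group (t : ℝ) (v : W) : W :=
  ∑' k, Complex.exp (exo.freq k * t) • ∑ l : Fin (exo.n k), exo.coeff k l v •
    ∑ j : Fin (exo.n k) with j ≤ l,
      ((t : ℂ) ^ ((l : ℕ) - (j : ℕ)) / (((l : ℕ) - (j : ℕ)).factorial : ℂ)) • exo.φ ⟨k, j⟩

end Exosystem

/-! ### The plant, the controller and the closed loop -/

section Systems

variable {ι X U Y Z W : Type*}
  [NormedAddCommGroup X] [NormedSpace ℂ X] [NormedAddCommGroup U] [NormedSpace ℂ U]
  [NormedAddCommGroup Y] [NormedSpace ℂ Y] [NormedAddCommGroup Z] [NormedSpace ℂ Z]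
  [NormedAddCommGroup W] [InnerProductSpace ℂ W]

/-- A plant `(A, B, C, D)` with state space `X`, input space `U` and output space `Y`, together with the
operators `E`, `F` through which the exosystem acts on it. The domain of `C` may be larger than
`D(A)`. The field `regular` says that the range of `R(l, A₋₁)B` is contained in `D(C)` and that
`C R(l, A₋₁) B` is bounded. -/
structure Plant (X U Y W : Type*)
    [NormedAddCommGroup X] [NormedSpace ℂ X] [NormedAddCommGroup U] [NormedSpace ℂ U]
    [NormedAddCommGroup Y] [NormedSpace ℂ Y] [NormedAddCommGroup W] [InnerProductSpace ℂ W] where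
  A : X →ₗ.[ℂ] X
  generates : ∃ T : ℝ → X →L[ℂ] X, Generates A T
  l₀ : ℂ
  l₀_mem : l₀ ∈ resolventSet A
  B : U →L[ℂ] Extrap (resolvent A l₀)
  C : X →ₗ.[ℂ] Y
  C_bounded : RelBounded C A
  D : U →L[ℂ] Y
  E : W →L[ℂ] X
  F : W →L[ℂ] Y
  regular : ∀ l ∈ resolventSet A, ∃ Q : U →L[ℂ] Y, ∀ u : U, ∃ x : X,
    l • toExtrap (resolvent A l₀) x - extrapOp A l₀ x = B u ∧ (x, Q u) ∈ C.graph

/-- A dynamic error feedback controller `(G₁, G₂, K)` on `Z`, with `K` a bounded operator from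
`D(G₁)` with the graph norm to `U`. -/
structure Controller (Z U Y : Type*)
    [NormedAddCommGroup Z] [NormedSpace ℂ Z] [NormedAddCommGroup U] [NormedSpace ℂ U]
    [NormedAddCommGroup Y] [NormedSpace ℂ Y] where
  G₁ : Z →ₗ.[ℂ] Z
  generates : ∃ T : ℝ → Z →L[ℂ] Z, Generates G₁ T
  G₂ : Y →L[ℂ] Z
  K : G₁.domain →ₗ[ℂ] U
  K_bounded : RelBounded (⟨G₁.domain, K⟩ : Z →ₗ.[ℂ] U) G₁

/-- The operator `C_e (x, z) = C x + D K z` on `D(C) × D(G₁)`. -/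
def Ce (P : Plant X U Y W) (G : Controller Z U Y) : X × Z →ₗ.[ℂ] Y :=
  P.C.coprod ⟨G.G₁.domain, P.D.toLinearMap ∘ₗ G.K⟩

/-- The projection of `D(C) × D(G₁)` to `D(G₁)`. -/
def ctrlPart (P : Plant X U Y W) (G : Controller Z U Y) : (Ce P G).domain →ₗ[ℂ] G.G₁.domain :=
  ((LinearMap.snd ℂ X Z) ∘ₗ (Ce P G).domain.subtype).codRestrict G.G₁.domain fun p => p.2.2

/-- The first component `A₋₁ x + B K z ∈ X₋₁` of the closed-loop operator. -/
def AeTop (P : Plant X U Y W) (G : Controller Z U Y) :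
    (Ce P G).domain →ₗ[ℂ] Extrap (resolvent P.A P.l₀) :=
  (extrapOp P.A P.l₀).toLinearMap ∘ₗ (LinearMap.fst ℂ X Z) ∘ₗ (Ce P G).domain.subtype +
    P.B.toLinearMap ∘ₗ G.K ∘ₗ ctrlPart P G

/-- The second component `G₂ C x + (G₁ + G₂ D K) z` of the closed-loop operator. -/
def AeBot (P : Plant X U Y W) (G : Controller Z U Y) : (Ce P G).domain →ₗ[ℂ] Z :=
  G.G₁.toFun ∘ₗ ctrlPart P G + G.G₂.toLinearMap ∘ₗ (Ce P G).toFun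

/-- The graph of the closed-loop operator on its maximal domain, the pairs
`(x, z) ∈ D(C) × D(G₁)` with `A₋₁ x + B K z ∈ X`. -/
def AeGraph (P : Plant X U Y W) (G : Controller Z U Y) : Submodule ℂ ((X × Z) × (X × Z)) where
  carrier := {q | ∃ h : q.1 ∈ (Ce P G).domain,
    AeTop P G ⟨q.1, h⟩ = toExtrap (resolvent P.A P.l₀) q.2.1 ∧ AeBot P G ⟨q.1, h⟩ = q.2.2}
  zero_mem' := by
    refine ⟨Submodule.zero_mem _, ?_, ?_⟩
    · exact (map_zero (AeTop P G)).trans (map_zero _).symm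
    · exact map_zero (AeBot P G)
  add_mem' := by
    rintro q r ⟨hq, hq1, hq2⟩ ⟨hr, hr1, hr2⟩
    refine ⟨Submodule.add_mem _ hq hr, ?_, ?_⟩
    · refine (map_add (AeTop P G) ⟨q.1, hq⟩ ⟨r.1, hr⟩).trans ?_
      rw [hq1, hr1]
      exact (map_add _ _ _).symm
    · refine (map_add (AeBot P G) ⟨q.1, hq⟩ ⟨r.1, hr⟩).trans ?_
      rw [hq2, hr2]
      rfl
  smul_mem' := by
    rintro a q ⟨hq, hq1, hq2⟩
    refine ⟨Submodule.smul_mem _ a hq, ?_, ?_⟩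
    · refine (map_smul (AeTop P G) a ⟨q.1, hq⟩).trans ?_
      rw [hq1]
      exact (map_smul _ _ _).symm
    · refine (map_smul (AeBot P G) a ⟨q.1, hq⟩).trans ?_
      rw [hq2]
      rfl

/-- The closed-loop system operator `A_e` on `X × Z`, with its maximal domain. -/
def Ae (P : Plant X U Y W) (G : Controller Z U Y) : X × Z →ₗ.[ℂ] X × Z := (AeGraph P G).toLinearPMap

theorem Ae_graph (P : Plant X U Y W) (G : Controller Z U Y) : (Ae P G).graph = AeGraph P G := by
  refine Submodule.toLinearPMap_graph_eq _ ?_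
  rintro ⟨p, y, w⟩ ⟨h, h1, h2⟩ hp
  have h0 : (⟨p, h⟩ : (Ce P G).domain) = 0 := Subtype.ext hp
  simp only [h0, map_zero] at h1 h2
  exact Prod.ext (toExtrap_injective P.l₀_mem h1.symm) h2.symm

/-- The operator `B_e v = (E v, G₂ F v)`. -/
def Be (P : Plant X U Y W) (G : Controller Z U Y) : W →L[ℂ] X × Z := P.E.prod (G.G₂.comp P.F)

/-- The Sylvester equation `Σ S = A_e Σ + B_e` on `W_{α+1}` has a solution `Σ ∈ L(W_α, X × Z)`
that maps `W_{α+1}` into `D(A_e)`. -/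
def SylvesterSolvable [CompleteSpace W] (exo : Exosystem ι W) (α : ℝ)
    (P : Plant X U Y W) (G : Controller Z U Y) : Prop :=
  ∃ Sig : exo.scale α →ₗ[ℂ] X × Z,
    (∃ M : ℝ, ∀ v : exo.scale α, ‖Sig v‖ ≤ M * exo.scaleNorm α v) ∧
    ∀ v : exo.scale α, (v : W) ∈ exo.scale (α + 1) →
      ∃ (hS : (v : W) ∈ exo.S.domain) (hSα : exo.S ⟨v, hS⟩ ∈ exo.scale α)
        (hA : Sig v ∈ (Ae P G).domain),
        Sig ⟨exo.S ⟨v, hS⟩, hSα⟩ = Ae P G ⟨Sig v, hA⟩ + Be P G v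

/-- The mild state of the closed loop whose system operator generates `T`, with initial states `x₀` of the
closed loop and `v₀` of the exosystem. -/
def state (exo : Exosystem ι W) (P : Plant X U Y W)
    (G : Controller Z U Y) (T : ℝ → X × Z →L[ℂ] X × Z) (x₀ : X × Z) (v₀ : W) (t : ℝ) : X × Z :=
  T t x₀ + ∫ s in (0 : ℝ)..t, T (t - s) (Be P G (exo.group s v₀))

/-- For all `x₀ ∈ D(A_e)` and `v₀ ∈ W_{α+1}` the state stays in `D(C_e)` and the regulation error
`e(t) = C_e x_e(t) + F v(t)` tends to zero. -/
def ErrorDecays (exo : Exosystem ι W) (α : ℝ)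
    (P : Plant X U Y W) (G : Controller Z U Y) : Prop :=
  ∀ T : ℝ → X × Z →L[ℂ] X × Z, Generates (Ae P G) T →
    ∀ x₀ ∈ (Ae P G).domain, ∀ v₀ ∈ exo.scale (α + 1),
      ∃ e : ℝ → Y,
        (∀ t : ℝ, 0 ≤ t → ∃ h : state exo P G T x₀ v₀ t ∈ (Ce P G).domain,
          e t = Ce P G ⟨state exo P G T x₀ v₀ t, h⟩ + P.F (exo.group t v₀)) ∧
        Tendsto e atTop (𝓝 0)

/-- The class of admissible perturbed plants, for a given controller. -/
structure Admissible [CompleteSpace W] (exo : Exosystem ι W) (α : ℝ)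
    (G : Controller Z U Y) (P : Plant X U Y W) : Prop where
  freq_mem : ∀ k, exo.freq k ∈ resolventSet P.A
  stable : GeneratesStronglyStable (Ae P G)
  Ce_bounded : RelBounded (Ce P G) (Ae P G)
  sylvester : SylvesterSolvable exo α P G

/-- The controller solves the robust output regulation problem on `W_α` for the plant `P`. -/
structure SolvesRORP [CompleteSpace W] (exo : Exosystem ι W)
    (α : ℝ) (P : Plant X U Y W) (G : Controller Z U Y) : Prop where
  stable : GeneratesStronglyStable (Ae P G)
  regulation : ErrorDecays exo α P G
  robust : ∀ P' : Plant X U Y W, Admissible exo α G P' → ErrorDecays exo α P' G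

/-- `z 0, …, z (m-1)` satisfy the equations `(A - l) z_0 = 0`, `(A - l) z_{j+1} = z_j` of a Jordan
chain of `A` at `l`. -/
def IsJordanChain (A : Z →ₗ.[ℂ] Z) (l : ℂ) {m : ℕ} (z : Fin m → Z) : Prop :=
  ∀ j : Fin m, ∃ h : z j ∈ A.domain,
    A ⟨z j, h⟩ - l • z j =
      if (j : ℕ) = 0 then 0 else z ⟨(j : ℕ) - 1, lt_of_le_of_lt (Nat.sub_le _ _) j.2⟩

/-- The controller incorporates a p-copy internal model of the exosystem, `p = dim Y`: for all `k`
the kernel of `iω_k - G₁` has dimension at least `p`, and `G₁` has at least `p` independent Jordan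
chains of lengths at least `n_k` at `iω_k`. -/
def HasPCopy (exo : Exosystem ι W) (G : Controller Z U Y) : Prop :=
  ∀ k : ι,
    (Module.finrank ℂ Y : Cardinal) ≤ Module.rank ℂ (eigenspace G.G₁ (exo.freq k)) ∧
    ∃ (m : Fin (Module.finrank ℂ Y) → ℕ) (z : ∀ i, Fin (m i) → Z),
      (∀ i, exo.n k ≤ m i) ∧
      (∀ i, IsJordanChain G.G₁ (exo.freq k) (z i)) ∧
      LinearIndependent ℂ fun q : Σ i, Fin (m i) => z q.1 q.2

end Systems

end IMP

end

/-! Everything is read off one operator, C_eΣ + F on W_{α+1} (`regErr`). If Σ solves the Sylvester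
equation, the state is T_e(t)(x_e0 − Σv_0) + ΣT_S(t)v_0 (`state_eq`), so the error is a transient
plus (C_eΣ + F)T_S(t)v_0. The transient decays because C_e is A_e-bounded and T_e commutes with A_e.
On a block the other term is a polynomial times an exponential of modulus one. Hence the error
decays exactly when C_eΣ + F vanishes on all basis vectors (`regErr_basis_eq_zero`,
`regErr_eq_zero`, `errorDecays`).

Sufficiency. Let l = iω_k and Θ = P(l)K, with P(l) the transfer function of the nominal plant. Since
l − A_e is injective, so is w ↦ (l − G₁)w − G₂Θw. Thus Θ is injective on the span of the p chain
heads, which lie in ker(l − G₁), and p = dim Y makes it onto Y. If (l − G₁)x = G₂y, adding a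
combination of heads to x makes Θ take the value y; the sum is then 0, so y = 0 and x is in the span
of the heads (`eq_zero_of_chains`). This conclusion concerns the controller only, so it applies to
every perturbed plant. There the second row of the Sylvester equation reads (G₁ − l)ζ_j + G₂e_j =
ζ_{j−1}, where e_j are the values of the error operator. The chains are long enough to absorb
ζ_{j−1}, and induction on j gives e_j = 0.

Necessity. Add ⟨·, φ_k^0⟩y to F. Then A_e and C_e do not change, and Σ changes on block k by φ_k^j ↦
(−1)^j R(l, A_e)^{j+1}(0, G₂y) (`response`). Regulation before and after the change forces C_e to be
−y on the response for j = 0 and 0 for j > 0. In the second row of A_e this cancels the forcing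
through G₂, so the Z-components form Jordan chains of G₁ depending linearly on y. The heads
determine y because l ∈ ρ(A), and a basis of Y yields the p chains. -/

noncomputable section

namespace IMP

/-! ### Block structure of the exosystem -/

namespace Exosystem

variable {ι W V : Type*} [NormedAddCommGroup W] [InnerProductSpace ℂ W] (exo : Exosystem ι W)
variable [NormedAddCommGroup V] [NormedSpace ℂ V]

/-- The linear map that sends `φ_k^l` to `w l` and vanishes on the other blocks. -/
def ofBlock (k : ι) (w : Fin (exo.n k) → V) : W →ₗ[ℂ] V :=
  ∑ l : Fin (exo.n k), (exo.coeff k l).smulRight (w l)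

theorem ofBlock_apply (k : ι) (w : Fin (exo.n k) → V) (v : W) :
    exo.ofBlock k w v = ∑ l, exo.coeff k l v • w l := by
  simp [ofBlock]

theorem proj_eq_ofBlock (k : ι) : exo.proj k = exo.ofBlock k fun l => exo.φ ⟨k, l⟩ := rfl

theorem block_eq_ofBlock (k : ι) : exo.block k =
    exo.ofBlock k fun l => exo.freq k • exo.φ ⟨k, l⟩ + exo.prev k l := rfl

theorem coeff_basis_self (k : ι) (l j : Fin (exo.n k)) :
    exo.coeff k l (exo.φ ⟨k, j⟩) = if l = j then 1 else 0 := by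
  classical
  have := orthonormal_iff_ite.1 exo.φ.orthonormal ⟨k, l⟩ ⟨k, j⟩
  simpa [coeff] using this

theorem coeff_basis_of_ne {k m : ι} (h : k ≠ m) (l : Fin (exo.n k)) (j : Fin (exo.n m)) :
    exo.coeff k l (exo.φ ⟨m, j⟩) = 0 :=
  exo.φ.orthonormal.2 fun e => h (congrArg Sigma.fst e)

theorem coeff_proj_self (k : ι) (l : Fin (exo.n k)) (v : W) :
    exo.coeff k l (exo.proj k v) = exo.coeff k l v := by
  simp [proj_eq_ofBlock, ofBlock_apply, coeff_basis_self]

theorem coeff_proj_of_ne {k m : ι} (h : k ≠ m) (l : Fin (exo.n k)) (v : W) :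
    exo.coeff k l (exo.proj m v) = 0 := by
  simp [proj_eq_ofBlock, ofBlock_apply, exo.coeff_basis_of_ne h]

theorem ofBlock_proj_self (k : ι) (w : Fin (exo.n k) → V) (v : W) :
    exo.ofBlock k w (exo.proj k v) = exo.ofBlock k w v := by
  simp [ofBlock_apply, coeff_proj_self]

theorem ofBlock_proj_of_ne {k m : ι} (h : k ≠ m) (w : Fin (exo.n k) → V) (v : W) :
    exo.ofBlock k w (exo.proj m v) = 0 := by
  simp [ofBlock_apply, exo.coeff_proj_of_ne h]

theorem ofBlock_basis (k : ι) (w : Fin (exo.n k) → V) (l : Fin (exo.n k)) :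
    exo.ofBlock k w (exo.φ ⟨k, l⟩) = w l := by
  simp [ofBlock_apply, coeff_basis_self]

theorem proj_basis (k : ι) (l : Fin (exo.n k)) :
    exo.proj k (exo.φ ⟨k, l⟩) = exo.φ ⟨k, l⟩ := exo.ofBlock_basis k _ l

theorem map_ofBlock {V' : Type*} [NormedAddCommGroup V'] [NormedSpace ℂ V']
    (L : V →ₗ[ℂ] V') (k : ι) (w : Fin (exo.n k) → V) (v : W) :
    L (exo.ofBlock k w v) = exo.ofBlock k (fun l => L (w l)) v := by
  simp [ofBlock_apply]

theorem proj_prev (k : ι) (l : Fin (exo.n k)) : exo.proj k (exo.prev k l) = exo.prev k l := by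
  unfold prev
  split_ifs
  · simp
  · exact exo.proj_basis k _

theorem proj_proj (k : ι) (v : W) : exo.proj k (exo.proj k v) = exo.proj k v :=
  exo.ofBlock_proj_self k _ v

theorem proj_block (k : ι) (v : W) : exo.proj k (exo.block k v) = exo.block k v := by
  rw [block_eq_ofBlock, map_ofBlock]
  simp [proj_prev, proj_basis]

theorem block_proj (k : ι) (v : W) : exo.block k (exo.proj k v) = exo.block k v :=
  exo.ofBlock_proj_self k _ v

theorem block_proj_of_ne {k m : ι} (h : k ≠ m) (v : W) : exo.block k (exo.proj m v) = 0 :=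
  exo.ofBlock_proj_of_ne h _ v

theorem proj_of_ne {k m : ι} (h : k ≠ m) {v : W} (hv : exo.proj m v = v) : exo.proj k v = 0 := by
  rw [← hv]; exact exo.ofBlock_proj_of_ne h _ v

/-! ### Orthogonality of the blocks and continuity of blockwise maps -/

theorem norm_coeff_le (k : ι) (l : Fin (exo.n k)) (v : W) :
    ‖exo.coeff k l v‖ ≤ ‖exo.proj k v‖ := by
  rw [← coeff_proj_self]
  refine (norm_inner_le_norm (𝕜 := ℂ) (exo.φ ⟨k, l⟩) (exo.proj k v)).trans ?_
  rw [exo.φ.orthonormal.1, one_mul]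

theorem norm_ofBlock_le (k : ι) (w : Fin (exo.n k) → V) (v : W) :
    ‖exo.ofBlock k w v‖ ≤ (∑ l, ‖w l‖) * ‖exo.proj k v‖ := by
  rw [ofBlock_apply, Finset.sum_mul]
  refine (norm_sum_le _ _).trans (Finset.sum_le_sum fun l _ => ?_)
  rw [norm_smul, mul_comm]
  gcongr
  exact exo.norm_coeff_le k l v

theorem hasSum_proj (v : W) : HasSum (fun k => exo.proj k v) v := by
  refine (exo.φ.hasSum_repr v).sigma fun k => ?_
  have h : exo.proj k v = ∑ l, exo.φ.repr v ⟨k, l⟩ • exo.φ ⟨k, l⟩ := by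
    rw [proj_eq_ofBlock, ofBlock_apply]
    refine Finset.sum_congr rfl fun l _ => ?_
    rw [exo.φ.repr_apply_apply]; rfl
  rw [h]
  exact hasSum_fintype _

theorem orthogonalFamily : OrthogonalFamily ℂ (fun k => LinearMap.range (exo.proj k))
    fun k => (LinearMap.range (exo.proj k)).subtypeₗᵢ := by
  rintro k m hkm ⟨_, a, rfl⟩ ⟨_, b, rfl⟩
  change inner ℂ (exo.proj k a) (exo.proj m b) = 0
  rw [proj_eq_ofBlock, proj_eq_ofBlock, ofBlock_apply, ofBlock_apply, sum_inner]
  refine Finset.sum_eq_zero fun l _ => ?_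
  rw [inner_sum]
  refine Finset.sum_eq_zero fun j _ => ?_
  have h0 : inner ℂ (exo.φ ⟨k, l⟩) (exo.φ ⟨m, j⟩) = 0 := exo.coeff_basis_of_ne hkm l j
  simp [inner_smul_left, inner_smul_right, h0]

theorem norm_sq_sum {x : ι → W} (hx : ∀ k, exo.proj k (x k) = x k) (s : Finset ι) :
    ‖∑ k ∈ s, x k‖ ^ 2 = ∑ k ∈ s, ‖x k‖ ^ 2 :=
  exo.orthogonalFamily.norm_sum (fun k => ⟨x k, x k, hx k⟩) s

theorem summable_of_norm_sq [CompleteSpace W] {x : ι → W} (hx : ∀ k, exo.proj k (x k) = x k)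
    (h : Summable fun k => ‖x k‖ ^ 2) : Summable x :=
  (exo.orthogonalFamily.summable_iff_norm_sq_summable (fun k => ⟨x k, x k, hx k⟩)).2 h

/-- By orthogonality the numbers ‖∑_{k ∈ s} P_k v‖² increase with s, and they converge to ‖v‖². -/
theorem sum_norm_sq_proj_le (v : W) (s : Finset ι) : ∑ k ∈ s, ‖exo.proj k v‖ ^ 2 ≤ ‖v‖ ^ 2 := by
  rw [← exo.norm_sq_sum (fun k => exo.proj_proj k v)]
  have h0 : Tendsto (fun s : Finset ι => ‖∑ k ∈ s, exo.proj k v‖ ^ 2) atTop (𝓝 (‖v‖ ^ 2)) :=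
    ((exo.hasSum_proj v).norm).pow 2
  refine Monotone.ge_of_tendsto (fun s t hst => ?_) h0 s
  simp only [exo.norm_sq_sum (fun k => exo.proj_proj k v)]
  exact Finset.sum_le_sum_of_subset_of_nonneg hst fun _ _ _ => sq_nonneg _

theorem summable_norm_sq_proj (v : W) : Summable fun k => ‖exo.proj k v‖ ^ 2 :=
  summable_of_sum_le (fun _ => sq_nonneg _) (exo.sum_norm_sq_proj_le v)

theorem norm_proj_le (k : ι) (v : W) : ‖exo.proj k v‖ ≤ ‖v‖ := by
  have := exo.sum_norm_sq_proj_le v {k}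
  rw [Finset.sum_singleton] at this
  exact (sq_le_sq₀ (norm_nonneg _) (norm_nonneg _)).1 this

theorem continuous_proj (k : ι) : Continuous (exo.proj k) :=
  AddMonoidHomClass.continuous_of_bound (exo.proj k) 1 fun v => by
    rw [one_mul]; exact exo.norm_proj_le k v

theorem continuous_ofBlock (k : ι) (w : Fin (exo.n k) → V) : Continuous (exo.ofBlock k w) :=
  AddMonoidHomClass.continuous_of_bound (exo.ofBlock k w) (∑ l, ‖w l‖) fun v =>
    (exo.norm_ofBlock_le k w v).trans (by gcongr; exact exo.norm_proj_le k v)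

theorem proj_of_hasSum {x : ι → W} (hx : ∀ k, exo.proj k (x k) = x k) {v : W} (h : HasSum x v)
    (k : ι) : exo.proj k v = x k := by
  have h1 : HasSum (fun m => exo.proj k (x m)) (exo.proj k v) := h.mapL ⟨exo.proj k, exo.continuous_proj k⟩
  refine h1.unique ?_
  convert hasSum_single k fun m hm => exo.proj_of_ne hm.symm (hx m) using 1
  exact (hx k).symm

/-! ### Scale spaces -/

theorem mem_scale {α : ℝ} {v : W} :
    v ∈ exo.scale α ↔ Summable fun k => (1 + exo.ω k ^ 2) ^ α * ‖exo.proj k v‖ ^ 2 := Iff.rfl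

theorem one_le_weight {α : ℝ} (hα : 0 ≤ α) (k : ι) : (1 : ℝ) ≤ (1 + exo.ω k ^ 2) ^ α :=
  Real.one_le_rpow (by nlinarith [sq_nonneg (exo.ω k)]) hα

theorem scale_anti {α β : ℝ} (h : α ≤ β) : exo.scale β ≤ exo.scale α := by
  intro v hv
  refine Summable.of_nonneg_of_le (fun k => by positivity) (fun k => ?_) hv
  have : (1 + exo.ω k ^ 2) ^ α ≤ (1 + exo.ω k ^ 2) ^ β :=
    Real.rpow_le_rpow_of_exponent_le (by nlinarith [sq_nonneg (exo.ω k)]) h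
  gcongr

theorem mem_scale_of_proj_eq {α : ℝ} {k : ι} {v : W} (hv : exo.proj k v = v) : v ∈ exo.scale α := by
  rw [mem_scale]
  refine summable_of_ne_finset_zero (s := {k}) fun m hm => ?_
  rw [Finset.mem_singleton] at hm
  rw [exo.proj_of_ne hm hv]
  simp

theorem proj_mem_scale (α : ℝ) (k : ι) (v : W) : exo.proj k v ∈ exo.scale α :=
  exo.mem_scale_of_proj_eq (exo.proj_proj k v)

theorem block_mem_scale (α : ℝ) (k : ι) (v : W) : exo.block k v ∈ exo.scale α :=
  exo.mem_scale_of_proj_eq (exo.proj_block k v)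

theorem basis_mem_scale (α : ℝ) (k : ι) (l : Fin (exo.n k)) : exo.φ ⟨k, l⟩ ∈ exo.scale α :=
  exo.mem_scale_of_proj_eq (exo.proj_basis k l)

theorem norm_proj_le_scaleNorm {α : ℝ} (hα : 0 ≤ α) {v : W} (hv : v ∈ exo.scale α) (k : ι) :
    ‖exo.proj k v‖ ≤ exo.scaleNorm α v := by
  refine Real.le_sqrt_of_sq_le ?_
  refine le_trans ?_ (hv.le_tsum k fun m _ => by positivity)
  exact le_mul_of_one_le_left (sq_nonneg _) (exo.one_le_weight hα k)

theorem tendsto_scaleNorm_sub_sum {α : ℝ} (v : W) :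
    Tendsto (fun s : Finset ι => exo.scaleNorm α (v - ∑ k ∈ s, exo.proj k v)) atTop (𝓝 0) := by
  classical
  -- No membership in W_α is needed: if the series diverges, so do its tails, and their `tsum` is
  -- the default value 0.
  have h0 := tendsto_tsum_compl_atTop_zero fun k => (1 + exo.ω k ^ 2) ^ α * ‖exo.proj k v‖ ^ 2
  have h1 := (Real.continuous_sqrt.tendsto 0).comp h0
  rw [Real.sqrt_zero] at h1
  refine h1.congr fun s => ?_
  simp only [Function.comp_apply, scaleNorm]
  congr 1
  refine (tsum_subtype {x | x ∉ s} fun k => (1 + exo.ω k ^ 2) ^ α * ‖exo.proj k v‖ ^ 2).trans ?_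
  refine tsum_congr fun m => ?_
  have h2 : exo.proj m (∑ k ∈ s, exo.proj k v) = if m ∈ s then exo.proj m v else 0 := by
    rw [map_sum]
    split_ifs with hm
    · rw [Finset.sum_eq_single_of_mem m hm, proj_proj]
      exact fun k _ hk => exo.proj_of_ne hk.symm (exo.proj_proj k v)
    · refine Finset.sum_eq_zero fun k hk => exo.proj_of_ne ?_ (exo.proj_proj k v)
      rintro rfl
      exact hm hk
  rw [map_sub, h2]
  by_cases hm : m ∈ s <;> simp [Set.indicator, hm]

/-- A linear map that is bounded on `W_α` is determined by its values on the blocks. -/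
theorem hasSum_map_proj {α : ℝ} {L : exo.scale α →ₗ[ℂ] V}
    (hL : ∃ M : ℝ, ∀ v : exo.scale α, ‖L v‖ ≤ M * exo.scaleNorm α v) (v : exo.scale α) :
    HasSum (fun k => L ⟨exo.proj k v, exo.proj_mem_scale α k v⟩) (L v) := by
  obtain ⟨M, hM⟩ := hL
  have h0 := (exo.tendsto_scaleNorm_sub_sum (α := α) (v : W)).const_mul M
  rw [mul_zero] at h0
  have h1 : Tendsto (fun s : Finset ι => L v -
      ∑ k ∈ s, L ⟨exo.proj k v, exo.proj_mem_scale α k v⟩) atTop (𝓝 0) := by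
    refine squeeze_zero_norm (fun s => ?_) h0
    rw [← map_sum, ← map_sub]
    refine (hM _).trans_eq ?_
    simp
  have h2 := (tendsto_const_nhds (x := L v)).sub h1
  simp only [sub_sub_cancel, sub_zero] at h2
  exact h2

/-! ### The operator `S` -/

section Generator

variable [CompleteSpace W]

theorem proj_S (v : exo.S.domain) (k : ι) : exo.proj k (exo.S v) = exo.block k v :=
  exo.proj_of_hasSum (fun k => exo.proj_block k v) (exo.summable_block v.2).hasSum k

theorem S_proj {k : ι} {v : W} (h : exo.proj k v ∈ exo.S.domain) :
    exo.S ⟨exo.proj k v, h⟩ = exo.block k v := by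
  change ∑' m, exo.block m (exo.proj k v) = _
  rw [tsum_eq_single k fun m hm => exo.block_proj_of_ne hm v, block_proj]

end Generator

/-! ### The group on the blocks -/

/-- The group `T_S(t)` on the block `k`. -/
def blockGroup (k : ι) (t : ℝ) : W →ₗ[ℂ] W :=
  Complex.exp (exo.freq k * t) • exo.ofBlock k fun l => ∑ j : Fin (exo.n k) with j ≤ l,
      ((t : ℂ) ^ ((l : ℕ) - (j : ℕ)) / (((l : ℕ) - (j : ℕ)).factorial : ℂ)) • exo.φ ⟨k, j⟩

theorem group_eq (t : ℝ) (v : W) : exo.group t v = ∑' k, exo.blockGroup k t v := by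
  simp [group, blockGroup, ofBlock_apply]

theorem proj_blockGroup (k : ι) (t : ℝ) (v : W) :
    exo.proj k (exo.blockGroup k t v) = exo.blockGroup k t v := by
  simp [blockGroup, map_ofBlock, map_sum, proj_basis]

theorem blockGroup_proj_of_ne {k m : ι} (h : k ≠ m) (t : ℝ) (v : W) :
    exo.blockGroup k t (exo.proj m v) = 0 := by
  simp [blockGroup, exo.ofBlock_proj_of_ne h]

theorem norm_exp_freq (k : ι) (t : ℝ) : ‖Complex.exp (exo.freq k * t)‖ = 1 := by
  rw [Complex.norm_exp]
  simp [freq]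

/-- The bound N on the block sizes makes the constant independent of k: at most N coefficients
occur, each with at most N vectors of norm at most (1 + |R|)^N. -/
theorem exists_blockGroup_bound (R : ℝ) : ∃ M : ℝ, 0 ≤ M ∧ ∀ t : ℝ, |t| ≤ R → ∀ k v,
    ‖exo.blockGroup k t v‖ ≤ M * ‖exo.proj k v‖ := by
  obtain ⟨N, hN⟩ := exo.n_bdd
  refine ⟨N * (N * (1 + |R|) ^ N), by positivity, fun t ht k v => ?_⟩
  have htR : |t| ≤ |R| := ht.trans (le_abs_self R)
  rw [blockGroup, LinearMap.smul_apply, norm_smul, norm_exp_freq, one_mul]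
  refine (exo.norm_ofBlock_le k _ v).trans ?_
  gcongr
  have hl : ∀ l : Fin (exo.n k), ‖∑ j : Fin (exo.n k) with j ≤ l,
      ((t : ℂ) ^ ((l : ℕ) - (j : ℕ)) / (((l : ℕ) - (j : ℕ)).factorial : ℂ)) • exo.φ ⟨k, j⟩‖
      ≤ N * (1 + |R|) ^ N := by
    intro l
    refine (norm_sum_le_of_le (f := _) (n := fun _ => (1 + |R|) ^ N) _ fun j _ => ?_).trans ?_
    · rw [norm_smul, exo.φ.orthonormal.1, mul_one, norm_div, norm_pow, Complex.norm_real,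
        Complex.norm_natCast, Real.norm_eq_abs]
      calc |t| ^ ((l : ℕ) - (j : ℕ)) / (((l : ℕ) - (j : ℕ)).factorial : ℝ)
          ≤ |t| ^ ((l : ℕ) - (j : ℕ)) := div_le_self (by positivity)
            (by exact_mod_cast Nat.factorial_pos _)
        _ ≤ (1 + |R|) ^ ((l : ℕ) - (j : ℕ)) := by gcongr; linarith
        _ ≤ (1 + |R|) ^ N := pow_le_pow_right₀ (by linarith [abs_nonneg R])
            (by have := l.2; have := hN k; omega)
    · rw [Finset.sum_const, nsmul_eq_mul]
      gcongr
      refine (Finset.card_le_univ _).trans ?_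
      simpa using hN k
  refine (Finset.sum_le_sum fun l _ => hl l).trans ?_
  rw [Finset.sum_const, nsmul_eq_mul]
  gcongr
  simpa using hN k

/-- Orthogonality keeps the constant independent of s, which supplies the dominating function when
the integral in `state_eq` is summed over the blocks. -/
theorem norm_sum_blockGroup_le {M t : ℝ} (hM : 0 ≤ M)
    (h : ∀ k v, ‖exo.blockGroup k t v‖ ≤ M * ‖exo.proj k v‖) (s : Finset ι) (v : W) :
    ‖∑ k ∈ s, exo.blockGroup k t v‖ ≤ M * ‖v‖ := by
  refine (sq_le_sq₀ (norm_nonneg _) (by positivity)).1 ?_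
  rw [exo.norm_sq_sum (fun k => exo.proj_blockGroup k t v)]
  calc ∑ k ∈ s, ‖exo.blockGroup k t v‖ ^ 2 ≤ ∑ k ∈ s, M ^ 2 * ‖exo.proj k v‖ ^ 2 := by
        refine Finset.sum_le_sum fun k _ => ?_
        rw [← mul_pow]
        exact pow_le_pow_left₀ (norm_nonneg _) (h k v) 2
    _ ≤ (M * ‖v‖) ^ 2 := by
        rw [← Finset.mul_sum, mul_pow]
        gcongr
        exact exo.sum_norm_sq_proj_le v s

theorem hasSum_blockGroup [CompleteSpace W] (t : ℝ) (v : W) :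
    HasSum (fun k => exo.blockGroup k t v) (exo.group t v) := by
  rw [group_eq]
  obtain ⟨M, hM, h⟩ := exo.exists_blockGroup_bound |t|
  refine (exo.summable_of_norm_sq (fun k => exo.proj_blockGroup k t v) ?_).hasSum
  refine Summable.of_nonneg_of_le (fun _ => sq_nonneg _) (fun k => ?_)
    ((exo.summable_norm_sq_proj v).mul_left (M ^ 2))
  rw [← mul_pow]
  exact pow_le_pow_left₀ (norm_nonneg _) (h t le_rfl k v) 2

theorem proj_group [CompleteSpace W] (t : ℝ) (v : W) (k : ι) :
    exo.proj k (exo.group t v) = exo.blockGroup k t v :=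
  exo.proj_of_hasSum (fun k => exo.proj_blockGroup k t v) (exo.hasSum_blockGroup t v) k

theorem group_of_proj_eq {k : ι} {v : W} (hv : exo.proj k v = v) (t : ℝ) :
    exo.group t v = exo.blockGroup k t v := by
  rw [group_eq, tsum_eq_single k fun m hm => ?_]
  rw [← hv, exo.blockGroup_proj_of_ne hm]

theorem group_mem_scale [CompleteSpace W] {α : ℝ} (t : ℝ) {v : W} (hv : v ∈ exo.scale α) :
    exo.group t v ∈ exo.scale α := by
  obtain ⟨M, hM, h⟩ := exo.exists_blockGroup_bound |t|
  rw [mem_scale] at hv ⊢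
  refine Summable.of_nonneg_of_le (fun k => by positivity) (fun k => ?_) (hv.mul_left (M ^ 2))
  rw [proj_group, mul_left_comm, ← mul_pow]
  gcongr
  exact h t le_rfl k v

theorem blockGroup_zero (k : ι) (v : W) : exo.blockGroup k 0 v = exo.proj k v := by
  have h : ∀ l : Fin (exo.n k), (∑ j : Fin (exo.n k) with j ≤ l,
      (((0 : ℝ) : ℂ) ^ ((l : ℕ) - (j : ℕ)) / (((l : ℕ) - (j : ℕ)).factorial : ℂ)) • exo.φ ⟨k, j⟩)
      = exo.φ ⟨k, l⟩ := by
    intro l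
    rw [Finset.sum_eq_single_of_mem l (by simp)]
    · simp
    · intro j hj hjl
      have : (l : ℕ) - (j : ℕ) ≠ 0 := by
        have h1 : j ≤ l := by simpa using hj
        have h2 : (j : ℕ) < l := lt_of_le_of_ne h1 (Fin.val_ne_of_ne hjl)
        omega
      simp [this]
  simp only [blockGroup, h]
  simp [proj_eq_ofBlock]

theorem hasDerivAt_pow_div_factorial (i : ℕ) (t : ℝ) :
    HasDerivAt (fun s : ℝ => (s : ℂ) ^ i / (i.factorial : ℂ))
      (if i = 0 then 0 else (t : ℂ) ^ (i - 1) / ((i - 1).factorial : ℂ)) t := by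
  have h := ((hasDerivAt_id (t : ℂ)).pow i).comp_ofReal.div_const (i.factorial : ℂ)
  refine h.congr_deriv ?_
  rcases i with _ | i
  · simp
  · have : (i.factorial : ℂ) ≠ 0 := by exact_mod_cast i.factorial_ne_zero
    have : (i + 1 : ℂ) ≠ 0 := by exact_mod_cast i.succ_ne_zero
    simp only [Nat.add_one_sub_one, Nat.add_eq_zero_iff, one_ne_zero, and_false, if_false,
      Nat.factorial_succ, id, mul_one]
    push_cast
    field_simp

/-- The nilpotent part of a block lowers the index of the coefficients by one; for c i = t^i / i!
this is differentiation in t. -/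
theorem sum_prev_eq (k : ι) (l : Fin (exo.n k)) (c : ℕ → ℂ) :
    ∑ j : Fin (exo.n k) with j ≤ l, c ((l : ℕ) - (j : ℕ)) • exo.prev k j =
      ∑ j : Fin (exo.n k) with j ≤ l,
        (if (l : ℕ) - (j : ℕ) = 0 then 0 else c ((l : ℕ) - (j : ℕ) - 1)) • exo.φ ⟨k, j⟩ := by
  have h1 : ∑ j : Fin (exo.n k) with j ≤ l, c ((l : ℕ) - (j : ℕ)) • exo.prev k j =
      ∑ j : Fin (exo.n k) with j ≤ l ∧ (j : ℕ) ≠ 0, c ((l : ℕ) - (j : ℕ)) • exo.prev k j := by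
    refine (Finset.sum_subset (fun j hj => ?_) fun j hj hj' => ?_).symm
    · simp only [Finset.mem_filter, Finset.mem_univ, true_and] at hj ⊢
      exact hj.1
    · simp only [Finset.mem_filter, Finset.mem_univ, true_and] at hj hj'
      have : (j : ℕ) = 0 := by tauto
      simp [prev, this]
  have h2 : ∑ j : Fin (exo.n k) with j ≤ l,
        (if (l : ℕ) - (j : ℕ) = 0 then 0 else c ((l : ℕ) - (j : ℕ) - 1)) • exo.φ ⟨k, j⟩ =
      ∑ j : Fin (exo.n k) with j < l,
        (if (l : ℕ) - (j : ℕ) = 0 then 0 else c ((l : ℕ) - (j : ℕ) - 1)) • exo.φ ⟨k, j⟩ := by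
    refine (Finset.sum_subset (fun j hj => ?_) fun j hj hj' => ?_).symm
    · simp only [Finset.mem_filter, Finset.mem_univ, true_and] at hj ⊢
      exact hj.le
    · simp only [Finset.mem_filter, Finset.mem_univ, true_and, not_lt] at hj hj'
      have : (l : ℕ) - (j : ℕ) = 0 := Nat.sub_eq_zero_of_le hj'
      simp [this]
  rw [h1, h2]
  -- On the left j = 0 has dropped out because `prev` vanishes there, on the right j = l because its
  -- coefficient is 0; j ↦ j − 1 matches what remains.
  refine Finset.sum_bij' (fun j _ => ⟨(j : ℕ) - 1, lt_of_le_of_lt (Nat.sub_le _ _) j.2⟩)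
    (fun j hj => ⟨(j : ℕ) + 1, by
      simp only [Finset.mem_filter, Finset.mem_univ, true_and, Fin.lt_def] at hj
      have := l.2
      omega⟩) ?_ ?_ ?_ ?_ ?_
  · intro j hj
    simp only [Finset.mem_filter, Finset.mem_univ, true_and, Fin.lt_def, Fin.le_def] at hj ⊢
    omega
  · intro j hj
    simp only [Finset.mem_filter, Finset.mem_univ, true_and, Fin.lt_def, Fin.le_def] at hj ⊢
    omega
  · intro j hj
    simp only [Finset.mem_filter, Finset.mem_univ, true_and] at hj
    ext
    simp only
    omega
  · intro j hj
    ext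
    simp
  · intro j hj
    simp only [Finset.mem_filter, Finset.mem_univ, true_and, Fin.le_def] at hj
    rw [prev, if_neg hj.2, if_neg (by simp only; omega)]
    congr 2
    simp only
    omega

/-- Product rule: the exponential produces the diagonal part iω_k of S_k, the polynomials its
nilpotent part. -/
theorem hasDerivAt_blockGroup (k : ι) (v : W) (t : ℝ) :
    HasDerivAt (fun s : ℝ => exo.blockGroup k s v) (exo.block k (exo.blockGroup k t v)) t := by
  have he : HasDerivAt (fun s : ℝ => Complex.exp (exo.freq k * s))
      (Complex.exp (exo.freq k * t) * exo.freq k) t := by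
    have h := ((hasDerivAt_id (t : ℂ)).const_mul (exo.freq k)).cexp.comp_ofReal
    simpa using h
  have hl : ∀ l : Fin (exo.n k), HasDerivAt (fun s : ℝ => ∑ j : Fin (exo.n k) with j ≤ l,
      ((s : ℂ) ^ ((l : ℕ) - (j : ℕ)) / (((l : ℕ) - (j : ℕ)).factorial : ℂ)) • exo.φ ⟨k, j⟩)
      (∑ j : Fin (exo.n k) with j ≤ l,
      ((t : ℂ) ^ ((l : ℕ) - (j : ℕ)) / (((l : ℕ) - (j : ℕ)).factorial : ℂ)) • exo.prev k j) t := by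
    intro l
    rw [exo.sum_prev_eq k l fun i => (t : ℂ) ^ i / (i.factorial : ℂ)]
    exact HasDerivAt.fun_sum fun j _ => (hasDerivAt_pow_div_factorial _ t).smul_const _
  have hs : HasDerivAt (fun s : ℝ => ∑ l, exo.coeff k l v • ∑ j : Fin (exo.n k) with j ≤ l,
      ((s : ℂ) ^ ((l : ℕ) - (j : ℕ)) / (((l : ℕ) - (j : ℕ)).factorial : ℂ)) • exo.φ ⟨k, j⟩) _ t :=
    HasDerivAt.fun_sum fun l _ => (hl l).const_smul (exo.coeff k l v)
  have h := he.smul hs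
  have e1 : (fun s : ℝ => exo.blockGroup k s v) = fun s : ℝ => Complex.exp (exo.freq k * s) •
      ∑ l, exo.coeff k l v • ∑ j : Fin (exo.n k) with j ≤ l,
      ((s : ℂ) ^ ((l : ℕ) - (j : ℕ)) / (((l : ℕ) - (j : ℕ)).factorial : ℂ)) • exo.φ ⟨k, j⟩ := by
    funext s
    simp [blockGroup, ofBlock_apply]
  rw [e1]
  refine h.congr_deriv ?_
  have hb : exo.block k (exo.blockGroup k t v) = Complex.exp (exo.freq k * t) •
      ∑ l, exo.coeff k l v • ∑ j : Fin (exo.n k) with j ≤ l,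
        ((t : ℂ) ^ ((l : ℕ) - (j : ℕ)) / (((l : ℕ) - (j : ℕ)).factorial : ℂ)) •
          (exo.freq k • exo.φ ⟨k, j⟩ + exo.prev k j) := by
    rw [blockGroup, LinearMap.smul_apply, map_smul, map_ofBlock, ofBlock_apply]
    simp only [map_sum, map_smul, block_eq_ofBlock, ofBlock_basis]
  rw [hb]
  simp only [smul_add, Finset.sum_add_distrib, Finset.smul_sum, smul_smul]
  rw [add_comm]
  congr 1
  refine Finset.sum_congr rfl fun l _ => Finset.sum_congr rfl fun j _ => ?_
  congr 1
  ring

end Exosystem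

/-! ### Strongly continuous semigroups -/

section Semigroups

variable {H : Type*} [NormedAddCommGroup H] [NormedSpace ℂ H]

theorem apply_of_mem_graph {V : Type*} [NormedAddCommGroup V] [NormedSpace ℂ V]
    {A : H →ₗ.[ℂ] V} {x : H} {y : V} (h : (x, y) ∈ A.graph) (hx : x ∈ A.domain) : A ⟨x, hx⟩ = y :=
  ((LinearPMap.image_iff hx).2 h).symm

theorem IsC0Semigroup.exists_bound [CompleteSpace H] {T : ℝ → H →L[ℂ] H} (hT : IsC0Semigroup T)
    (t : ℝ) : ∃ M : ℝ, 0 ≤ M ∧ ∀ s ∈ Set.Icc 0 t, ‖T s‖ ≤ M := by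
  obtain ⟨M, hM⟩ := banach_steinhaus (g := fun s : Set.Icc 0 t => T s) fun x => by
    obtain ⟨C, hC⟩ := isCompact_Icc.exists_bound_of_continuousOn
      ((hT.cont x).mono Set.Icc_subset_Ici_self)
    exact ⟨C, fun s => hC s s.2⟩
  exact ⟨max M 0, le_max_right _ _, fun s hs => (hM ⟨s, hs⟩).trans (le_max_left _ _)⟩

/-- Write T(τ)f = T(τ)y + T(τ)(f − y): strong continuity handles the first term, uniform boundedness
on [0, t] the second. -/
theorem IsC0Semigroup.tendsto_apply [CompleteSpace H] {T : ℝ → H →L[ℂ] H} (hT : IsC0Semigroup T)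
    {β : Type*} {l : Filter β} {τ : β → ℝ} {f : β → H} {t s : ℝ} {y : H}
    (hτ : Tendsto τ l (𝓝 s)) (hs : 0 ≤ s) (hmem : ∀ᶠ b in l, τ b ∈ Set.Icc 0 t)
    (hf : Tendsto f l (𝓝 y)) : Tendsto (fun b => T (τ b) (f b)) l (𝓝 (T s y)) := by
  obtain ⟨M, hM0, hM⟩ := hT.exists_bound t
  have h1 : Tendsto (fun b => T (τ b) y) l (𝓝 (T s y)) := by
    refine (hT.cont y s hs).tendsto.comp (tendsto_nhdsWithin_iff.2 ⟨hτ, ?_⟩)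
    exact hmem.mono fun b hb => hb.1
  have h2 : Tendsto (fun b => T (τ b) (f b - y)) l (𝓝 0) := by
    have h3 : Tendsto (fun b => M * ‖f b - y‖) l (𝓝 0) := by
      have := ((tendsto_iff_norm_sub_tendsto_zero.1 hf).const_mul M)
      rwa [mul_zero] at this
    refine squeeze_zero_norm' ?_ h3
    filter_upwards [hmem] with b hb
    exact ((T (τ b)).le_opNorm _).trans (by gcongr; exact hM _ hb)
  have h4 := h1.add h2
  rw [add_zero] at h4
  refine h4.congr fun b => ?_
  rw [map_sub]; abel

theorem IsC0Semigroup.continuousOn_apply_sub [CompleteSpace H] {T : ℝ → H →L[ℂ] H}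
    (hT : IsC0Semigroup T) {t : ℝ} {u : ℝ → H} (hu : ContinuousOn u (Set.Icc 0 t)) :
    ContinuousOn (fun s => T (t - s) (u s)) (Set.Icc 0 t) := by
  intro s hs
  refine hT.tendsto_apply (t := t) (τ := fun r => t - r) ?_ (by linarith [hs.2]) ?_ (hu s hs)
  · exact (continuous_const.sub continuous_id).continuousWithinAt.tendsto
  · filter_upwards [self_mem_nhdsWithin] with r hr
    exact ⟨by linarith [hr.2], by linarith [hr.1]⟩

theorem Generates.map_mem_graph {A : H →ₗ.[ℂ] H} {T : ℝ → H →L[ℂ] H} (hT : Generates A T)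
    {x y : H} (h : (x, y) ∈ A.graph) {s : ℝ} (hs : 0 ≤ s) : (T s x, T s y) ∈ A.graph := by
  rw [hT.2] at h ⊢
  have h1 := ((T s).continuous.tendsto y).comp h
  refine h1.congr' ?_
  filter_upwards [self_mem_nhdsWithin] with r hr
  have hr' : (0 : ℝ) ≤ r := le_of_lt hr
  simp only [Function.comp_apply, map_smul, map_sub]
  rw [← mul_apply_eq_comp, ← mul_apply_eq_comp, ← hT.1.add s r hs hr',
    ← hT.1.add r s hr' hs, add_comm]

/-- This turns the one-sided complex difference quotients in `Generates` into right derivatives, for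
which the fundamental theorem of calculus is available. -/
theorem hasDerivWithinAt_Ioi_iff {f : ℝ → H} {f' : H} {s : ℝ} :
    HasDerivWithinAt f f' (Set.Ioi s) s ↔
      Tendsto (fun h : ℝ => (h : ℂ)⁻¹ • (f (s + h) - f s)) (𝓝[>] 0) (𝓝 f') := by
  rw [hasDerivWithinAt_iff_tendsto_slope' (by simp)]
  have e : 𝓝[>] s = map (fun h : ℝ => s + h) (𝓝[>] 0) := by
    have h := (Homeomorph.addLeft s).isEmbedding.map_nhdsWithin_eq (Set.Ioi 0) 0
    rw [Homeomorph.coe_addLeft, Set.image_const_add_Ioi, add_zero] at h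
    rw [h]
    exact congrArg (𝓝[Set.Ioi s] ·) (add_zero s).symm
  rw [e, tendsto_map'_iff]
  refine tendsto_congr fun h => ?_
  simp only [Function.comp_apply, slope_def_module, add_sub_cancel_left]
  rw [← Complex.ofReal_inv, Complex.coe_smul]

/-- Variation of constants: a solution of the inhomogeneous equation with right-hand side `A u + g` is
the mild solution. -/
theorem Generates.variation_of_constants [CompleteSpace H] {A : H →ₗ.[ℂ] H} {T : ℝ → H →L[ℂ] H}
    (hT : Generates A T) {u g : ℝ → H} {t : ℝ} (ht : 0 ≤ t)
    (hu : ContinuousOn u (Set.Icc 0 t)) (hg : ContinuousOn g (Set.Icc 0 t))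
    (hd : ∀ s ∈ Set.Ioo 0 t, ∃ y, (u s, y) ∈ A.graph ∧ HasDerivWithinAt u (y + g s) (Set.Ioi s) s) :
    u t = T t (u 0) + ∫ s in (0 : ℝ)..t, T (t - s) (g s) := by
  have key := intervalIntegral.integral_eq_sub_of_hasDeriv_right (a := 0) (b := t)
    (f := fun s => T (t - s) (u s)) (f' := fun s => T (t - s) (g s)) ?_ ?_ ?_
  · rw [key]
    simp [hT.1.zero]
  · rw [Set.uIcc_of_le ht]; exact hT.1.continuousOn_apply_sub hu
  · rw [min_eq_left ht, max_eq_right ht]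
    intro s hs
    obtain ⟨y, hy, hd⟩ := hd s hs
    rw [hasDerivWithinAt_Ioi_iff] at hd ⊢
    have hy' := (hT.2 _ _).1 hy
    have h1 := hd.sub hy'
    rw [add_sub_cancel_left] at h1
    have hτ : Tendsto (fun h : ℝ => t - (s + h)) (𝓝[>] 0) (𝓝 (t - s)) := by
      have : Continuous fun h : ℝ => t - (s + h) := by fun_prop
      have := (this.tendsto 0).mono_left (nhdsWithin_le_nhds (s := Set.Ioi 0))
      simpa using this
    have hsmall : ∀ᶠ h : ℝ in 𝓝[>] 0, h ∈ Set.Ioo 0 (t - s) :=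
      Ioo_mem_nhdsGT (by linarith [hs.2])
    have h2 := hT.1.tendsto_apply (t := t) hτ (by linarith [hs.2]) (by
      filter_upwards [hsmall] with h hh
      exact ⟨by linarith [hh.2], by linarith [hh.1, hs.1]⟩) h1
    refine h2.congr' ?_
    filter_upwards [hsmall] with h hh
    -- Splitting off T(h) writes the difference quotient as T(t − s − h) applied to the quotient of
    -- u minus that of the orbit of u(s); the generator term y cancels and g(s) is left.
    have e : T (t - s) (u s) = T (t - (s + h)) (T h (u s)) := by
      rw [← mul_apply_eq_comp, ← hT.1.add _ _ (by linarith [hh.2]) hh.1.le]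
      congr 2; ring
    rw [e, ← smul_sub, map_smul, ← map_sub]
    congr 2
    abel
  · refine ContinuousOn.intervalIntegrable ?_
    rw [Set.uIcc_of_le ht]; exact hT.1.continuousOn_apply_sub hg

/-- Orbits that start in the domain are determined by the generator. -/
theorem Generates.apply_eq [CompleteSpace H] {A : H →ₗ.[ℂ] H} {T T' : ℝ → H →L[ℂ] H}
    (hT : Generates A T) (hT' : Generates A T') {x : H} (hx : x ∈ A.domain) {t : ℝ} (ht : 0 ≤ t) :
    T' t x = T t x := by
  have h := hT.variation_of_constants (u := fun s => T' s x) (g := fun _ => 0) ht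
    ((hT'.1.cont x).mono Set.Icc_subset_Ici_self) continuousOn_const fun s hs => by
      have hg := hT'.map_mem_graph (A.mem_graph ⟨x, hx⟩) hs.1.le
      refine ⟨_, hg, ?_⟩
      rw [add_zero, hasDerivWithinAt_Ioi_iff]
      refine ((hT'.2 _ _).1 hg).congr' ?_
      filter_upwards [self_mem_nhdsWithin] with r hr
      have hr' : (0 : ℝ) ≤ r := le_of_lt hr
      rw [add_comm s r, hT'.1.add r s hr' hs.1.le]
      rfl
  simpa [hT'.1.zero] using h

/-- The averages h⁻¹ ∫₀ʰ T(s)x ds lie in the domain and tend to x as h → 0+. -/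
theorem Generates.dense_domain [CompleteSpace H] {A : H →ₗ.[ℂ] H} {T : ℝ → H →L[ℂ] H}
    (hT : Generates A T) : Dense (A.domain : Set H) := by
  intro x
  -- T is arbitrary at negative times; `max s 0` gives a function continuous on all of ℝ.
  let g : ℝ → H := fun s => T (max s 0) x
  have hg : Continuous g := by
    have := (hT.1.cont x).comp_continuous (f := fun s : ℝ => max s 0) (by fun_prop) fun s => by simp
    exact this
  have hgi : ∀ a b : ℝ, IntervalIntegrable g MeasureTheory.volume a b :=
    fun a b => hg.intervalIntegrable a b
  let Φ : ℝ → H := fun r => ∫ s in (0 : ℝ)..r, g s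
  have hΦ : ∀ r, HasDerivAt Φ (g r) r := fun r => intervalIntegral.integral_hasDerivAt_right
    (hgi 0 r) (hg.stronglyMeasurableAtFilter _ _) hg.continuousAt
  have hΦ' : ∀ r, Tendsto (fun h : ℝ => (h : ℂ)⁻¹ • (Φ (r + h) - Φ r)) (𝓝[>] 0) (𝓝 (g r)) :=
    fun r => hasDerivWithinAt_Ioi_iff.1 (hΦ r).hasDerivWithinAt
  have hΦ0 : Φ 0 = 0 := by simp [Φ]
  have hmem : ∀ h : ℝ, 0 < h → Φ h ∈ A.domain := by
    intro h hh
    have h1 := (hΦ' h).sub (hΦ' 0)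
    refine LinearPMap.mem_domain_iff.2 ⟨g h - g 0, (hT.2 _ _).2 (h1.congr' ?_)⟩
    filter_upwards [self_mem_nhdsWithin] with r hr
    have hr' : (0 : ℝ) < r := hr
    rw [← smul_sub]
    congr 1
    have e1 : T r (Φ h) = ∫ s in (0 : ℝ)..h, g (s + r) := by
      have := (T r).intervalIntegral_comp_comm (hgi 0 h)
      rw [← this]
      refine intervalIntegral.integral_congr fun s hs => ?_
      rw [Set.uIcc_of_le hh.le] at hs
      simp only [g]
      rw [max_eq_left hs.1, max_eq_left (by linarith [hs.1]), add_comm s r,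
        hT.1.add r s hr'.le hs.1]
      rfl
    rw [e1, intervalIntegral.integral_comp_add_right, zero_add, hΦ0, sub_zero]
    have e2 : Φ (h + r) = Φ r + ∫ s in r..(h + r), g s :=
      (intervalIntegral.integral_add_adjacent_intervals (hgi _ _) (hgi _ _)).symm
    rw [e2]
    abel
  have h0 := hΦ' 0
  simp only [zero_add, hΦ0, sub_zero] at h0
  have hg0 : g 0 = x := by simp [g, hT.1.zero]
  rw [hg0] at h0
  refine mem_closure_of_tendsto h0 ?_
  filter_upwards [self_mem_nhdsWithin] with h hh
  exact A.domain.smul_mem _ (hmem h hh)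

theorem IsResolvent.mem_graph {A : H →ₗ.[ℂ] H} {l : ℂ} {R : H →L[ℂ] H} (h : IsResolvent A l R)
    (x : H) : (R x, l • R x - x) ∈ A.graph := by
  obtain ⟨hd, hx⟩ := h.1 x
  rw [← LinearPMap.image_iff hd]
  nth_rewrite 2 [← hx]
  abel

theorem eq_zero_of_mem_resolventSet {A : H →ₗ.[ℂ] H} {l : ℂ} (h : l ∈ resolventSet A) {x : H}
    (hx : (x, l • x) ∈ A.graph) : x = 0 := by
  obtain ⟨R, hR⟩ := h
  have hd : x ∈ A.domain := LinearPMap.mem_domain_of_mem_graph hx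
  have h1 := hR.2 ⟨x, hd⟩
  rw [apply_of_mem_graph hx hd] at h1
  simpa using h1.symm

end Semigroups

/-! ### The extrapolated operator -/

section Extrapolation

variable {X : Type*} [NormedAddCommGroup X] [NormedSpace ℂ X]

/-- The isometric extension of `R` to the completion of `X` in the norm `‖R x‖`. -/
def extrapInv [CompleteSpace X] (R : X →L[ℂ] X) : Extrap R →L[ℂ] X :=
  R.toLinearMap.extendOfNorm (toExtrap R)

theorem extrapInv_toExtrap [CompleteSpace X] (R : X →L[ℂ] X) (x : X) :
    extrapInv R (toExtrap R x) = R x :=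
  LinearMap.extendOfNorm_eq (f := R.toLinearMap) (e := toExtrap R)
    (UniformSpace.Completion.denseRange_coe (α := PreExtrap R))
    ⟨1, fun x => by rw [one_mul, norm_toExtrap]; exact le_rfl⟩ x

theorem extrapInv_extrapOp [CompleteSpace X] {A : X →ₗ.[ℂ] X} {l : ℂ}
    (hd : Dense (A.domain : Set X)) (h : l ∈ resolventSet A) (x : X) :
    extrapInv (resolvent A l) (l • toExtrap (resolvent A l) x - extrapOp A l x) = x := by
  rw [map_sub, map_smul, extrapInv_toExtrap]
  refine hd.induction (P := fun x => l • resolvent A l x -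
    extrapInv (resolvent A l) (extrapOp A l x) = x) (fun y hy => ?_) ?_ x
  · rw [extrapOp_apply hd h ⟨y, hy⟩, extrapInv_toExtrap, ← map_smul, ← map_sub]
    exact (isResolvent_resolvent h).2 ⟨y, hy⟩
  · exact isClosed_eq (by fun_prop) continuous_id

/-- Applying the extension of R(l, A) to (l − A₋₁)x = (l − m)x gives x = R(l, A)(l − m)x. So x is in
D(A) with Ax = mx, and m ∈ ρ(A). -/
theorem extrapOp_injective [CompleteSpace X] {A : X →ₗ.[ℂ] X} {l m : ℂ}
    (hd : Dense (A.domain : Set X)) (h : l ∈ resolventSet A) (hm : m ∈ resolventSet A) {x : X}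
    (hx : extrapOp A l x = m • toExtrap (resolvent A l) x) : x = 0 := by
  have h1 := extrapInv_extrapOp hd h x
  rw [hx, ← sub_smul, ← map_smul, extrapInv_toExtrap] at h1
  have h2 := (isResolvent_resolvent h).mem_graph ((l - m) • x)
  rw [h1] at h2
  refine eq_zero_of_mem_resolventSet hm ?_
  convert h2 using 2
  module

end Extrapolation

/-! ### Sylvester equation and state of the closed loop -/

section Sylvester

variable {ι X U Y Z W : Type*}
  [NormedAddCommGroup X] [NormedSpace ℂ X] [NormedAddCommGroup U] [NormedSpace ℂ U]
  [NormedAddCommGroup Y] [NormedSpace ℂ Y] [NormedAddCommGroup Z] [NormedSpace ℂ Z]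
  [NormedAddCommGroup W] [InnerProductSpace ℂ W]

theorem RelBounded.norm_le {H V : Type*} [NormedAddCommGroup H] [NormedSpace ℂ H]
    [NormedAddCommGroup V] [NormedSpace ℂ V] {C : H →ₗ.[ℂ] V} {A : H →ₗ.[ℂ] H}
    (h : RelBounded C A) : ∃ M : ℝ, ∀ x y (hx : x ∈ C.domain), (x, y) ∈ A.graph →
      ‖C ⟨x, hx⟩‖ ≤ M * (‖x‖ + ‖y‖) := by
  obtain ⟨hd, M, hM⟩ := h
  refine ⟨M, fun x y hx hxy => ?_⟩
  have hxA : x ∈ A.domain := LinearPMap.mem_domain_of_mem_graph hxy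
  have := hM ⟨x, hxA⟩
  rwa [apply_of_mem_graph hxy hxA] at this

theorem RelBounded.mem_domain {H V : Type*} [NormedAddCommGroup H] [NormedSpace ℂ H]
    [NormedAddCommGroup V] [NormedSpace ℂ V] {C : H →ₗ.[ℂ] V} {A : H →ₗ.[ℂ] H}
    (h : RelBounded C A) {x : H} (hx : x ∈ A.domain) : x ∈ C.domain :=
  h.choose hx

/-- A relatively bounded operator maps graph convergence to zero to convergence to zero. -/
theorem RelBounded.tendsto_zero {H V : Type*} [NormedAddCommGroup H] [NormedSpace ℂ H]
    [NormedAddCommGroup V] [NormedSpace ℂ V] {C : H →ₗ.[ℂ] V} {A : H →ₗ.[ℂ] H}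
    (h : RelBounded C A) {β : Type*} {l : Filter β} {x y : β → H} {e : β → V}
    (hxy : ∀ᶠ b in l, (x b, y b) ∈ A.graph ∧ (x b, e b) ∈ C.graph)
    (hx : Tendsto x l (𝓝 0)) (hy : Tendsto y l (𝓝 0)) : Tendsto e l (𝓝 0) := by
  obtain ⟨M, hM⟩ := h.norm_le
  have h0 : Tendsto (fun b => M * (‖x b‖ + ‖y b‖)) l (𝓝 0) := by
    simpa using (hx.norm.add hy.norm).const_mul M
  refine squeeze_zero_norm' ?_ h0
  filter_upwards [hxy] with b hb
  have hd : x b ∈ C.domain := LinearPMap.mem_domain_of_mem_graph hb.2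
  rw [← apply_of_mem_graph hb.2 hd]
  exact hM _ _ hd hb.1

/-- `Sig` is a bounded solution of the Sylvester equation on `W_α`. -/
structure IsSylvesterSolution [CompleteSpace W] (exo : Exosystem ι W) (α : ℝ)
    (P : Plant X U Y W) (G : Controller Z U Y) (Sig : exo.scale α →ₗ[ℂ] X × Z) : Prop where
  bounded : ∃ M : ℝ, ∀ v : exo.scale α, ‖Sig v‖ ≤ M * exo.scaleNorm α v
  equation : ∀ v : exo.scale α, (v : W) ∈ exo.scale (α + 1) →
      ∃ (hS : (v : W) ∈ exo.S.domain) (hSα : exo.S ⟨v, hS⟩ ∈ exo.scale α)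
        (hA : Sig v ∈ (Ae P G).domain),
        Sig ⟨exo.S ⟨v, hS⟩, hSα⟩ = Ae P G ⟨Sig v, hA⟩ + Be P G v

theorem Exosystem.map_eq_ofBlock {V : Type*} [NormedAddCommGroup V] [NormedSpace ℂ V]
    (exo : Exosystem ι W) {α : ℝ} (Sig : exo.scale α →ₗ[ℂ] V) {k : ι} {w : W}
    (hw : exo.proj k w = w) (hmem : w ∈ exo.scale α) : Sig ⟨w, hmem⟩ =
      exo.ofBlock k (fun l => Sig ⟨exo.φ ⟨k, l⟩, exo.basis_mem_scale α k l⟩) w := by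
  rw [exo.ofBlock_apply]
  simp only [← map_smul, ← map_sum]
  congr 1
  ext
  simp only [Submodule.coe_sum, Submodule.coe_smul]
  conv_lhs => rw [← hw]
  rw [exo.proj_eq_ofBlock, exo.ofBlock_apply]

namespace IsSylvesterSolution

variable [CompleteSpace W] {exo : Exosystem ι W} {α : ℝ} {P : Plant X U Y W}
  {G : Controller Z U Y} {Sig : exo.scale α →ₗ[ℂ] X × Z}

theorem graph_block (h : IsSylvesterSolution exo α P G Sig) (k : ι) (v : W) :
    (Sig ⟨exo.proj k v, exo.proj_mem_scale α k v⟩,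
      Sig ⟨exo.block k v, exo.block_mem_scale α k v⟩ - Be P G (exo.proj k v)) ∈ (Ae P G).graph := by
  obtain ⟨hS, hSα, hA, he⟩ := h.equation ⟨exo.proj k v, exo.proj_mem_scale α k v⟩
    (exo.proj_mem_scale (α + 1) k v)
  rw [← LinearPMap.image_iff hA]
  rw [sub_eq_iff_eq_add, ← he]
  congr 2
  exact (exo.S_proj hS).symm

theorem mem_domain (h : IsSylvesterSolution exo α P G Sig) {v : W} (hv : v ∈ exo.scale (α + 1)) :
    Sig ⟨v, exo.scale_anti (by linarith) hv⟩ ∈ (Ae P G).domain :=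
  (h.equation ⟨v, exo.scale_anti (by linarith) hv⟩ hv).choose_spec.choose_spec.choose

/-- On a single block the exosystem orbit is differentiable for every v, and by the Sylvester
equation its image under Σ solves u' = A_e u + B_e T_S(s)P_k v. Variation of constants then applies.
-/
theorem map_blockGroup [CompleteSpace X] [CompleteSpace Z] (h : IsSylvesterSolution exo α P G Sig)
    {T : ℝ → X × Z →L[ℂ] X × Z} (hT : Generates (Ae P G) T) (k : ι) (v : W) {t : ℝ} (ht : 0 ≤ t) :
    Sig ⟨exo.blockGroup k t v, exo.mem_scale_of_proj_eq (exo.proj_blockGroup k t v)⟩ =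
      T t (Sig ⟨exo.proj k v, exo.proj_mem_scale α k v⟩) +
        ∫ s in (0 : ℝ)..t, T (t - s) (Be P G (exo.blockGroup k s v)) := by
  let w : Fin (exo.n k) → X × Z := fun l => Sig ⟨exo.φ ⟨k, l⟩, exo.basis_mem_scale α k l⟩
  -- Σ lives on W_α only; on block k it agrees with the bounded map L on all of W, through which one
  -- can differentiate.
  let L : W →L[ℂ] X × Z := ⟨exo.ofBlock k w, exo.continuous_ofBlock k w⟩
  have hL : ∀ {x : W} (hx : exo.proj k x = x),
      Sig ⟨x, exo.mem_scale_of_proj_eq hx⟩ = L x := fun hx => exo.map_eq_ofBlock Sig hx _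
  have hcont : Continuous fun s : ℝ => exo.blockGroup k s v :=
    continuous_iff_continuousAt.2 fun s => (exo.hasDerivAt_blockGroup k v s).continuousAt
  have key := hT.variation_of_constants (u := fun s => L (exo.blockGroup k s v))
    (g := fun s => Be P G (exo.blockGroup k s v)) ht (L.continuous.comp hcont).continuousOn
    ((Be P G).continuous.comp hcont).continuousOn fun s _ => by
      have hg := h.graph_block k (exo.blockGroup k s v)
      refine ⟨L (exo.block k (exo.blockGroup k s v)) - Be P G (exo.blockGroup k s v), ?_, ?_⟩
      · rw [← hL (exo.proj_block k _), ← hL (exo.proj_blockGroup k s v)]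
        convert hg using 4 <;> exact (exo.proj_blockGroup k s v).symm
      · rw [sub_add_cancel]
        exact ((L.restrictScalars ℝ).hasFDerivAt.comp_hasDerivAt s
          (exo.hasDerivAt_blockGroup k v s)).hasDerivWithinAt
  rw [hL (exo.proj_blockGroup k t v), hL (exo.proj_proj k v), key, exo.blockGroup_zero]

/-- The state of the closed loop in terms of a solution of the Sylvester equation. -/
theorem state_eq [Countable ι] [CompleteSpace X] [CompleteSpace Z]
    (h : IsSylvesterSolution exo α P G Sig)
    {T : ℝ → X × Z →L[ℂ] X × Z} (hT : Generates (Ae P G) T) (x₀ : X × Z) (v : exo.scale α)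
    {t : ℝ} (ht : 0 ≤ t) :
    state exo P G T x₀ v t = T t (x₀ - Sig v) + Sig ⟨exo.group t v, exo.group_mem_scale t v.2⟩ := by
  obtain ⟨M, hM0, hM⟩ := exo.exists_blockGroup_bound t
  obtain ⟨N, hN0, hN⟩ := hT.1.exists_bound t
  have hcont : ∀ k, Continuous fun s : ℝ => exo.blockGroup k s v := fun k =>
    continuous_iff_continuousAt.2 fun s => (exo.hasDerivAt_blockGroup k v s).continuousAt
  have hci : ∀ k, ContinuousOn (fun s => T (t - s) (Be P G (exo.blockGroup k s v)))
      (Set.Icc 0 t) := fun k =>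
    hT.1.continuousOn_apply_sub ((Be P G).continuous.comp (hcont k)).continuousOn
  have h1 : HasSum (fun k => Sig ⟨exo.blockGroup k t v,
      exo.mem_scale_of_proj_eq (exo.proj_blockGroup k t v)⟩)
      (Sig ⟨exo.group t v, exo.group_mem_scale t v.2⟩) := by
    have := exo.hasSum_map_proj h.bounded ⟨exo.group t v, exo.group_mem_scale t v.2⟩
    simpa only [exo.proj_group] using this
  have h2 : HasSum (fun k => T t (Sig ⟨exo.proj k v, exo.proj_mem_scale α k v⟩)) (T t (Sig v)) :=
    (exo.hasSum_map_proj h.bounded v).mapL (T t)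
  -- Dominated convergence along finite sets of blocks; countability of ι makes this filter
  -- countably generated.
  have h3 : HasSum (fun k => ∫ s in (0 : ℝ)..t, T (t - s) (Be P G (exo.blockGroup k s v)))
      (∫ s in (0 : ℝ)..t, T (t - s) (Be P G (exo.group s v))) := by
    have h4 := intervalIntegral.tendsto_integral_filter_of_dominated_convergence
      (l := (atTop : Filter (Finset ι))) (a := 0) (b := t) (μ := MeasureTheory.volume)
      (F := fun F s => ∑ k ∈ F, T (t - s) (Be P G (exo.blockGroup k s v)))
      (f := fun s => T (t - s) (Be P G (exo.group s v)))
      (fun _ => N * (‖Be P G‖ * (M * ‖(v : W)‖))) ?_ ?_ intervalIntegrable_const ?_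
    · refine h4.congr fun F => ?_
      exact intervalIntegral.integral_finsetSum fun k _ =>
        ContinuousOn.intervalIntegrable (by rw [Set.uIcc_of_le ht]; exact hci k)
    · refine Eventually.of_forall fun F => ?_
      rw [Set.uIoc_of_le ht]
      exact ((continuousOn_finsetSum F fun k _ => hci k).mono
        Set.Ioc_subset_Icc_self).aestronglyMeasurable measurableSet_Ioc
    · refine Eventually.of_forall fun F => Eventually.of_forall fun s hs => ?_
      rw [Set.uIoc_of_le ht] at hs
      rw [← map_sum, ← map_sum]
      refine ((T (t - s)).le_opNorm _).trans ?_
      gcongr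
      · exact hN _ ⟨by linarith [hs.2], by linarith [hs.1]⟩
      · refine ((Be P G).le_opNorm _).trans ?_
        gcongr
        exact exo.norm_sum_blockGroup_le hM0 (hM s (abs_le.2 ⟨by linarith [hs.1], hs.2⟩)) F v
    · exact Eventually.of_forall fun s _ =>
        ((exo.hasSum_blockGroup s (v : W)).mapL (Be P G)).mapL (T (t - s))
  have h5 : Sig ⟨exo.group t v, exo.group_mem_scale t v.2⟩ =
      T t (Sig v) + ∫ s in (0 : ℝ)..t, T (t - s) (Be P G (exo.group s v)) := by
    refine h1.unique ((h2.add h3).congr_fun ?_)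
    exact fun k => h.map_blockGroup hT k v ht
  rw [h5, state, map_sub]
  abel

/-! ### The regulation error -/

/-- The operator `C_e Σ + F` on `W_{α+1}`. -/
def regErr (h : IsSylvesterSolution exo α P G Sig) (hCe : RelBounded (Ce P G) (Ae P G)) :
    exo.scale (α + 1) →ₗ[ℂ] Y :=
  (Ce P G).toFun ∘ₗ LinearMap.codRestrict (Ce P G).domain
    (Sig ∘ₗ Submodule.inclusion (exo.scale_anti (by linarith : α ≤ α + 1)))
    (fun v => hCe.mem_domain (h.mem_domain v.2)) + P.F.toLinearMap ∘ₗ (exo.scale (α + 1)).subtype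

theorem regErr_apply (h : IsSylvesterSolution exo α P G Sig) (hCe : RelBounded (Ce P G) (Ae P G))
    (v : exo.scale (α + 1)) : h.regErr hCe v =
      Ce P G ⟨Sig ⟨v, exo.scale_anti (by linarith) v.2⟩, hCe.mem_domain (h.mem_domain v.2)⟩ +
        P.F v := rfl

/-- C_eΣ is not assumed continuous on W_α. But ∑ ΣP_k v converges, and so does its image under A_e,
because A_eΣ = ΣS − B_e; this is convergence in the graph norm, which C_e respects. -/
theorem hasSum_regErr (h : IsSylvesterSolution exo α P G Sig)
    (hCe : RelBounded (Ce P G) (Ae P G)) (v : exo.scale (α + 1)) :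
    HasSum (fun k => h.regErr hCe ⟨exo.proj k v, exo.proj_mem_scale _ k v⟩) (h.regErr hCe v) := by
  have hv : (v : W) ∈ exo.scale α := exo.scale_anti (by linarith) v.2
  obtain ⟨hS, hSα, hA, he⟩ := h.equation ⟨v, hv⟩ v.2
  have h1 := exo.hasSum_map_proj h.bounded ⟨v, hv⟩
  have h2 := (exo.hasSum_map_proj h.bounded ⟨exo.S ⟨v, hS⟩, hSα⟩).sub
    ((exo.hasSum_proj (v : W)).mapL (Be P G))
  simp only [exo.proj_S] at h2
  rw [he, add_sub_cancel_right] at h2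
  have h3 := (exo.hasSum_proj (v : W)).mapL P.F
  have hd : Sig ⟨v, hv⟩ ∈ (Ce P G).domain := hCe.mem_domain hA
  have hdk : ∀ k, Sig ⟨exo.proj k v, exo.proj_mem_scale α k v⟩ ∈ (Ce P G).domain := fun k =>
    hCe.mem_domain (h.mem_domain (exo.proj_mem_scale _ k v))
  have h4 : HasSum (fun k => Ce P G ⟨Sig ⟨exo.proj k v, exo.proj_mem_scale α k v⟩, hdk k⟩)
      (Ce P G ⟨Sig ⟨v, hv⟩, hd⟩) := by
    have h5 := hCe.tendsto_zero (l := (atTop : Filter (Finset ι)))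
      (x := fun F => ∑ k ∈ F, Sig ⟨exo.proj k v, exo.proj_mem_scale α k v⟩ - Sig ⟨v, hv⟩)
      (y := fun F => ∑ k ∈ F, (Sig ⟨exo.block k v, exo.block_mem_scale α k v⟩ -
        Be P G (exo.proj k v)) - Ae P G ⟨Sig ⟨v, hv⟩, hA⟩)
      (e := fun F => ∑ k ∈ F, Ce P G ⟨Sig ⟨exo.proj k v, exo.proj_mem_scale α k v⟩, hdk k⟩ -
        Ce P G ⟨Sig ⟨v, hv⟩, hd⟩) ?_ ?_ ?_
    · have := h5.add_const (Ce P G ⟨Sig ⟨v, hv⟩, hd⟩)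
      simp only [sub_add_cancel, zero_add] at this
      exact this
    · refine Eventually.of_forall fun F => ⟨?_, ?_⟩
      · have := (Ae P G).graph.sub_mem ((Ae P G).graph.sum_mem fun k (_ : k ∈ F) =>
          h.graph_block k (v : W)) ((Ae P G).mem_graph ⟨Sig ⟨v, hv⟩, hA⟩)
        convert this using 1
        refine Prod.ext ?_ ?_ <;>
          simp only [Prod.fst_sub, Prod.snd_sub, Prod.fst_sum, Prod.snd_sum]
      · have := (Ce P G).graph.sub_mem ((Ce P G).graph.sum_mem fun k (_ : k ∈ F) =>
          (Ce P G).mem_graph ⟨_, hdk k⟩) ((Ce P G).mem_graph ⟨Sig ⟨v, hv⟩, hd⟩)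
        convert this using 1
        refine Prod.ext ?_ ?_ <;>
          simp only [Prod.fst_sub, Prod.snd_sub, Prod.fst_sum, Prod.snd_sum]
    · have := Tendsto.sub_const h1 (Sig ⟨v, hv⟩)
      rwa [sub_self] at this
    · have := Tendsto.sub_const h2 (Ae P G ⟨Sig ⟨v, hv⟩, hA⟩)
      rwa [sub_self] at this
  exact h4.add h3

theorem regErr_eq_zero (h : IsSylvesterSolution exo α P G Sig)
    (hCe : RelBounded (Ce P G) (Ae P G))
    (h0 : ∀ k l, h.regErr hCe ⟨exo.φ ⟨k, l⟩, exo.basis_mem_scale _ k l⟩ = 0)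
    (v : exo.scale (α + 1)) : h.regErr hCe v = 0 := by
  refine (h.hasSum_regErr hCe v).unique ?_
  convert hasSum_zero with k
  rw [exo.map_eq_ofBlock (h.regErr hCe) (exo.proj_proj k v), exo.ofBlock_apply]
  simp [h0]

/-- If `C_e Σ + F = 0` then the regulation error decays. -/
theorem errorDecays [Countable ι] [CompleteSpace X] [CompleteSpace Z]
    (h : IsSylvesterSolution exo α P G Sig) (hCe : RelBounded (Ce P G) (Ae P G))
    (hst : GeneratesStronglyStable (Ae P G)) (h0 : ∀ v, h.regErr hCe v = 0) :
    ErrorDecays exo α P G := by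
  intro T hT x₀ hx₀ v₀ hv₀
  obtain ⟨T', hT', hs⟩ := hst
  have hv : v₀ ∈ exo.scale α := exo.scale_anti (by linarith) hv₀
  have hx : x₀ - Sig ⟨v₀, hv⟩ ∈ (Ae P G).domain :=
    (Ae P G).domain.sub_mem hx₀ (h.mem_domain hv₀)
  -- The transient tends to 0 in the graph norm. Its image under A_e is expressed by the stable
  -- semigroup T', since T and T' are known to agree only on D(A_e).
  have hg : ∀ t : ℝ, 0 ≤ t → (T t (x₀ - Sig ⟨v₀, hv⟩), T' t (Ae P G ⟨_, hx⟩)) ∈ (Ae P G).graph := by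
    intro t ht
    rw [hT'.apply_eq hT hx ht]
    exact hT'.map_mem_graph ((Ae P G).mem_graph ⟨_, hx⟩) ht
  have hd1 : ∀ t : ℝ, 0 ≤ t → T t (x₀ - Sig ⟨v₀, hv⟩) ∈ (Ce P G).domain := fun t ht =>
    hCe.mem_domain (LinearPMap.mem_domain_of_mem_graph (hg t ht))
  have hd2 : ∀ t : ℝ, Sig ⟨exo.group t v₀, exo.group_mem_scale t hv⟩ ∈ (Ce P G).domain := fun t =>
    hCe.mem_domain (h.mem_domain (exo.group_mem_scale t hv₀))
  have hd : ∀ t : ℝ, 0 ≤ t → state exo P G T x₀ v₀ t ∈ (Ce P G).domain := fun t ht => by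
    rw [h.state_eq hT x₀ ⟨v₀, hv⟩ ht]
    exact (Ce P G).domain.add_mem (hd1 t ht) (hd2 t)
  have he : ∀ (t : ℝ) (ht : 0 ≤ t), Ce P G ⟨state exo P G T x₀ v₀ t, hd t ht⟩ +
      P.F (exo.group t v₀) = Ce P G ⟨_, hd1 t ht⟩ := by
    intro t ht
    have e1 : (⟨state exo P G T x₀ v₀ t, hd t ht⟩ : (Ce P G).domain) =
        ⟨_, hd1 t ht⟩ + ⟨_, hd2 t⟩ := Subtype.ext (h.state_eq hT x₀ ⟨v₀, hv⟩ ht)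
    have e2 := h0 ⟨exo.group t v₀, exo.group_mem_scale t hv₀⟩
    rw [h.regErr_apply] at e2
    rw [e1, LinearPMap.map_add, add_assoc]
    exact (congrArg _ e2).trans (add_zero _)
  classical
  refine ⟨fun t => if ht : 0 ≤ t then Ce P G ⟨_, hd1 t ht⟩ else 0, fun t ht => ⟨hd t ht, ?_⟩, ?_⟩
  · rw [he t ht]
    exact dif_pos ht
  · refine hCe.tendsto_zero (x := fun t => T t (x₀ - Sig ⟨v₀, hv⟩))
      (y := fun t => T' t (Ae P G ⟨_, hx⟩)) ?_ ?_ (hs _)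
    · filter_upwards [eventually_ge_atTop 0] with t ht
      refine ⟨hg t ht, ?_⟩
      rw [dif_pos ht]
      exact (Ce P G).mem_graph ⟨_, hd1 t ht⟩
    · refine (hs (x₀ - Sig ⟨v₀, hv⟩)).congr' ?_
      filter_upwards [eventually_ge_atTop 0] with t ht
      exact (hT'.apply_eq hT hx ht).symm

/-- If the regulation error decays then `C_e Σ + F` vanishes on the basis vectors. -/
theorem regErr_basis_eq_zero [Countable ι] [CompleteSpace X] [CompleteSpace Z]
    (h : IsSylvesterSolution exo α P G Sig) (hCe : RelBounded (Ce P G) (Ae P G))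
    {T : ℝ → X × Z →L[ℂ] X × Z} (hT : Generates (Ae P G) T) (he : ErrorDecays exo α P G)
    (k : ι) (l : Fin (exo.n k)) :
    h.regErr hCe ⟨exo.φ ⟨k, l⟩, exo.basis_mem_scale _ k l⟩ = 0 := by
  obtain ⟨l, hl⟩ := l
  induction l using Nat.strong_induction_on with
  | _ l ih =>
    let w : Fin (exo.n k) → Y := fun j =>
      h.regErr hCe ⟨exo.φ ⟨k, j⟩, exo.basis_mem_scale (α + 1) k j⟩
    have hb := exo.basis_mem_scale (α + 1) k ⟨l, hl⟩
    have hb' := exo.basis_mem_scale α k ⟨l, hl⟩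
    -- The initial state Σφ_k^l removes the transient, so the error is exactly the error operator
    -- along the exosystem orbit.
    obtain ⟨e, he1, he2⟩ := he T hT _ (h.mem_domain hb) _ hb
    have hexp : ∀ t : ℝ, 0 ≤ t → e t = Complex.exp (exo.freq k * t) • w ⟨l, hl⟩ := by
      intro t ht
      obtain ⟨hd, het⟩ := he1 t ht
      have e1 := h.state_eq hT (Sig ⟨exo.φ ⟨k, ⟨l, hl⟩⟩, hb'⟩) ⟨exo.φ ⟨k, ⟨l, hl⟩⟩, hb'⟩ ht
      rw [sub_self, map_zero, zero_add] at e1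
      have e2 : e t = h.regErr hCe ⟨exo.group t (exo.φ ⟨k, ⟨l, hl⟩⟩), exo.group_mem_scale t hb⟩ := by
        rw [het, h.regErr_apply]
        congr 2
        exact Subtype.ext e1
      have e3 : exo.group t (exo.φ ⟨k, ⟨l, hl⟩⟩) = exo.blockGroup k t (exo.φ ⟨k, ⟨l, hl⟩⟩) :=
        exo.group_of_proj_eq (exo.proj_basis k _) t
      rw [e2, exo.map_eq_ofBlock (h.regErr hCe) (k := k) (by rw [e3, exo.proj_blockGroup]), e3,
        Exosystem.blockGroup, LinearMap.smul_apply, exo.ofBlock_basis, map_smul, map_sum]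
      simp only [map_smul, exo.ofBlock_basis]
      -- By the induction hypothesis the terms with positive powers of t vanish, leaving e^{iω_k t}
      -- times a constant vector.
      rw [Finset.sum_eq_single_of_mem ⟨l, hl⟩ (by simp)]
      · simp [w]
      · intro j hj hjl
        have h1 : j ≤ ⟨l, hl⟩ := by simpa using hj
        have h2 : (j : ℕ) < l := lt_of_le_of_ne h1 fun hh => hjl (Fin.ext hh)
        rw [ih j h2 j.2, smul_zero]
    have hn : Tendsto (fun t => ‖e t‖) atTop (𝓝 0) := by simpa using he2.norm
    have hc : Tendsto (fun _ : ℝ => ‖w ⟨l, hl⟩‖) atTop (𝓝 0) := by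
      refine hn.congr' ?_
      filter_upwards [eventually_ge_atTop 0] with t ht
      rw [hexp t ht, norm_smul, exo.norm_exp_freq, one_mul]
    exact norm_eq_zero.1 (tendsto_nhds_unique tendsto_const_nhds hc)

end IsSylvesterSolution

end Sylvester

section InternalModel

variable {ι X U Y Z W : Type*}
  [NormedAddCommGroup X] [NormedSpace ℂ X] [NormedAddCommGroup U] [NormedSpace ℂ U]
  [NormedAddCommGroup Y] [NormedSpace ℂ Y] [NormedAddCommGroup Z] [NormedSpace ℂ Z]
  [NormedAddCommGroup W] [InnerProductSpace ℂ W]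

/-! ### The closed-loop operator -/

theorem mem_Ae_graph {P : Plant X U Y W} {G : Controller Z U Y} {x a : X} {z b : Z} :
    ((x, z), (a, b)) ∈ (Ae P G).graph ↔ ∃ (hx : x ∈ P.C.domain) (hz : z ∈ G.G₁.domain),
      extrapOp P.A P.l₀ x + P.B (G.K ⟨z, hz⟩) = toExtrap (resolvent P.A P.l₀) a ∧
        G.G₁ ⟨z, hz⟩ + G.G₂ (P.C ⟨x, hx⟩ + P.D (G.K ⟨z, hz⟩)) = b := by
  rw [Ae_graph]
  constructor
  · rintro ⟨h, h1, h2⟩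
    exact ⟨h.1, h.2, h1, h2⟩
  · rintro ⟨hx, hz, h1, h2⟩
    exact ⟨⟨hx, hz⟩, h1, h2⟩

/-- The second row of A_e is G₁z + G₂C_e(x, z): the plant enters the controller equation only
through the output. -/
theorem graph_Ae_snd {P : Plant X U Y W} {G : Controller Z U Y} {p q : X × Z}
    (h : (p, q) ∈ (Ae P G).graph) (hp : p ∈ (Ce P G).domain) :
    (p.2, q.2 - G.G₂ (Ce P G ⟨p, hp⟩)) ∈ G.G₁.graph := by
  obtain ⟨hx, hz, -, h2⟩ := mem_Ae_graph.1 h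
  rw [← LinearPMap.image_iff hz, sub_eq_iff_eq_add]
  exact h2.symm

theorem graph_Ae_fst {P : Plant X U Y W} {G : Controller Z U Y} {p q : X × Z}
    (h : (p, q) ∈ (Ae P G).graph) (hp : p.2 = 0) :
    extrapOp P.A P.l₀ p.1 = toExtrap (resolvent P.A P.l₀) q.1 := by
  obtain ⟨x, z⟩ := p
  obtain ⟨hx, hz, h1, -⟩ := mem_Ae_graph.1 h
  obtain rfl : z = 0 := hp
  have hz0 : (⟨0, hz⟩ : G.G₁.domain) = 0 := rfl
  rwa [hz0, map_zero, map_zero, add_zero] at h1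

/-- A regular plant closes the loop for every controller state: `Θ = P(l) K`. -/
theorem exists_transfer {P : Plant X U Y W} (G : Controller Z U Y) {l : ℂ}
    (hl : l ∈ resolventSet P.A) : ∃ Θ : G.G₁.domain →ₗ[ℂ] Y, ∀ z : G.G₁.domain,
      ∃ x : X, ((x, (z : Z)), (l • x, G.G₁ z + G.G₂ (Θ z))) ∈ (Ae P G).graph := by
  obtain ⟨Q, hQ⟩ := P.regular l hl
  refine ⟨Q.toLinearMap ∘ₗ G.K + P.D.toLinearMap ∘ₗ G.K, fun z => ?_⟩
  obtain ⟨x, hx, hC⟩ := hQ (G.K z)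
  have hxC : x ∈ P.C.domain := LinearPMap.mem_domain_of_mem_graph hC
  refine ⟨x, mem_Ae_graph.2 ⟨hxC, z.2, ?_, ?_⟩⟩
  · change _ + P.B (G.K z) = _
    rw [← hx, map_smul]
    abel
  · rw [apply_of_mem_graph hC hxC]
    rfl

/-! ### Sufficiency of the internal model -/

theorem IsJordanChain.graph {A : Z →ₗ.[ℂ] Z} {l : ℂ} {m : ℕ} {z : Fin m → Z}
    (h : IsJordanChain A l z) (j : Fin m) : (z j, l • z j +
      if (j : ℕ) = 0 then 0 else z ⟨(j : ℕ) - 1, lt_of_le_of_lt (Nat.sub_le _ _) j.2⟩) ∈ A.graph := by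
  obtain ⟨hd, he⟩ := h j
  rw [← LinearPMap.image_iff hd, ← he]
  abel

/-- The span of the chain vectors of index at most `j`. -/
def chainSpan {p : ℕ} {m : Fin p → ℕ} (z : ∀ i, Fin (m i) → Z) (j : ℕ) : Submodule ℂ Z :=
  Submodule.span ℂ {x | ∃ (i : Fin p) (q : Fin (m i)), (q : ℕ) ≤ j ∧ x = z i q}

theorem chainSpan_mono {p : ℕ} {m : Fin p → ℕ} (z : ∀ i, Fin (m i) → Z) :
    Monotone (chainSpan z) := fun _ _ h =>
  Submodule.span_mono fun _ ⟨i, q, hq, hx⟩ => ⟨i, q, hq.trans h, hx⟩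

/-- A chain vector of index q ≤ j is the image under A − l of its successor, which exists because j
+ 1 < n ≤ m i. -/
theorem exists_preimage_of_mem_chainSpan {A : Z →ₗ.[ℂ] Z} {l : ℂ} {p n : ℕ} {m : Fin p → ℕ}
    {z : ∀ i, Fin (m i) → Z} (hm : ∀ i, n ≤ m i) (hz : ∀ i, IsJordanChain A l (z i))
    {j : ℕ} (hj : j + 1 < n) {x : Z} (hx : x ∈ chainSpan z j) :
    ∃ w ∈ chainSpan z (j + 1), (w, l • w + x) ∈ A.graph := by
  induction hx using Submodule.span_induction with
  | mem x hx =>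
    obtain ⟨i, q, hq, rfl⟩ := hx
    have hq' : (q : ℕ) + 1 < m i := by have := hm i; omega
    refine ⟨z i ⟨q + 1, hq'⟩, Submodule.subset_span ⟨i, _, by simpa using hq, rfl⟩, ?_⟩
    simpa using (hz i).graph ⟨q + 1, hq'⟩
  | zero => exact ⟨0, Submodule.zero_mem _, by simp⟩
  | add x y _ _ ihx ihy =>
    obtain ⟨a, ha, ha'⟩ := ihx
    obtain ⟨b, hb, hb'⟩ := ihy
    refine ⟨a + b, Submodule.add_mem _ ha hb, ?_⟩
    convert A.graph.add_mem ha' hb' using 1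
    rw [Prod.mk_add_mk]
    congr 1
    module
  | smul c x _ ih =>
    obtain ⟨a, ha, ha'⟩ := ih
    refine ⟨c • a, Submodule.smul_mem _ c ha, ?_⟩
    convert A.graph.smul_mem c ha' using 1
    rw [Prod.smul_mk]
    congr 1
    module

/-- With a p-copy internal model, `ran (l - G₁) ∩ ran G₂ = 0`, the operator `G₂` is injective, and
the kernel of `l - G₁` is spanned by the first vectors of the Jordan chains. -/
theorem eq_zero_of_chains [FiniteDimensional ℂ Y] {P : Plant X U Y W} {G : Controller Z U Y}
    {l : ℂ} (hA : l ∈ resolventSet P.A) (hAe : l ∈ resolventSet (Ae P G)) {n : ℕ} (hn : 0 < n)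
    {m : Fin (Module.finrank ℂ Y) → ℕ} {z : ∀ i, Fin (m i) → Z} (hm : ∀ i, n ≤ m i)
    (hz : ∀ i, IsJordanChain G.G₁ l (z i))
    (hind : LinearIndependent ℂ fun q : Σ i, Fin (m i) => z q.1 q.2)
    {x : Z} {y : Y} (hx : (x, l • x - G.G₂ y) ∈ G.G₁.graph) : y = 0 ∧ x ∈ chainSpan z 0 := by
  obtain ⟨Θ, hΘ⟩ := exists_transfer (P := P) G hA
  -- Injectivity of l − A_e, transferred to the controller state by choosing the plant component
  -- that solves the first row.
  have hinj : ∀ w : G.G₁.domain, G.G₁ w + G.G₂ (Θ w) = l • (w : Z) → w = 0 := by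
    intro w hw
    obtain ⟨a, ha⟩ := hΘ w
    rw [hw] at ha
    have h0 : (a, (w : Z)) = 0 := eq_zero_of_mem_resolventSet hAe ha
    exact Subtype.ext (Prod.ext_iff.1 h0).2
  have h0 : ∀ i, 0 < m i := fun i => hn.trans_le (hm i)
  have hg : ∀ i, (z i ⟨0, h0 i⟩, l • z i ⟨0, h0 i⟩) ∈ G.G₁.graph := fun i => by
    simpa using (hz i).graph ⟨0, h0 i⟩
  let c : Fin (Module.finrank ℂ Y) → G.G₁.domain := fun i =>
    ⟨z i ⟨0, h0 i⟩, LinearPMap.mem_domain_of_mem_graph (hg i)⟩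
  have hc : ∀ a : Fin (Module.finrank ℂ Y) → ℂ,
      G.G₁ (∑ i, a i • c i) = l • ((∑ i, a i • c i : G.G₁.domain) : Z) := by
    intro a
    have : ∀ i, G.G₁ (c i) = l • (c i : Z) := fun i => apply_of_mem_graph (hg i) _
    change G.G₁.toFun _ = _
    simp only [map_sum, map_smul, Submodule.coe_sum, Submodule.coe_smul, Finset.smul_sum]
    refine Finset.sum_congr rfl fun i _ => ?_
    rw [smul_comm, ← this]
    rfl
  -- On the heads l − G₁ vanishes, so `hinj` makes Θ injective on their span. There are dim Y of
  -- them, hence their images span Y.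
  have hcind : LinearIndependent ℂ fun i => Θ (c i) := by
    have hzi : LinearIndependent ℂ fun i => (c i : Z) :=
      hind.comp (fun i => (⟨i, ⟨0, h0 i⟩⟩ : Σ i, Fin (m i))) fun i j hij =>
        congrArg Sigma.fst hij
    rw [Fintype.linearIndependent_iff] at hzi ⊢
    intro a ha
    refine hzi a ?_
    have h1 : (∑ i, a i • c i) = 0 := by
      refine hinj _ ?_
      rw [hc a, map_sum]
      simp only [map_smul, ha, map_zero, add_zero]
    simpa using congrArg (Subtype.val) h1
  have hspan : Submodule.span ℂ (Set.range fun i => Θ (c i)) = ⊤ :=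
    hcind.span_eq_top_of_card_eq_finrank' (by simp)
  have hxd : x ∈ G.G₁.domain := LinearPMap.mem_domain_of_mem_graph hx
  have hy : y - Θ ⟨x, hxd⟩ ∈ Submodule.span ℂ (Set.range fun i => Θ (c i)) := by simp [hspan]
  obtain ⟨a, ha⟩ := (Submodule.mem_span_range_iff_exists_fun ℂ).1 hy
  -- With Θ equal to y the forcing G₂y becomes the feedback term itself, so the corrected vector
  -- satisfies the equation in `hinj`.
  have hΘy : Θ (⟨x, hxd⟩ + ∑ i, a i • c i) = y := by
    rw [map_add, map_sum]
    simp only [map_smul, ha]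
    abel
  have h1 : (⟨x, hxd⟩ + ∑ i, a i • c i : G.G₁.domain) = 0 := by
    refine hinj _ ?_
    rw [hΘy, LinearPMap.map_add, apply_of_mem_graph hx hxd, hc a, Submodule.coe_add]
    module
  refine ⟨by rw [← hΘy, h1, map_zero], ?_⟩
  have h2 : x = -∑ i, a i • z i ⟨0, h0 i⟩ := by
    have := congrArg (Subtype.val) h1
    simp only [Submodule.coe_add, Submodule.coe_sum, Submodule.coe_smul, Submodule.coe_zero] at this
    exact eq_neg_of_add_eq_zero_left this
  rw [h2]
  refine Submodule.neg_mem _ (Submodule.sum_mem _ fun i _ => Submodule.smul_mem _ _ ?_)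
  exact Submodule.subset_span ⟨i, _, le_rfl, rfl⟩

theorem Exosystem.block_basis (exo : Exosystem ι W) (k : ι) (l : Fin (exo.n k)) :
    exo.block k (exo.φ ⟨k, l⟩) = exo.freq k • exo.φ ⟨k, l⟩ + exo.prev k l :=
  exo.ofBlock_basis k _ l

/-- The Sylvester equation on a basis vector. -/
theorem IsSylvesterSolution.graph_basis [CompleteSpace W] {exo : Exosystem ι W} {α : ℝ}
    {P : Plant X U Y W} {G : Controller Z U Y} {Sig : exo.scale α →ₗ[ℂ] X × Z}
    (h : IsSylvesterSolution exo α P G Sig) (k : ι) (l : Fin (exo.n k)) :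
    (Sig ⟨exo.φ ⟨k, l⟩, exo.basis_mem_scale α k l⟩,
      exo.freq k • Sig ⟨exo.φ ⟨k, l⟩, exo.basis_mem_scale α k l⟩ +
        (if (l : ℕ) = 0 then 0 else Sig ⟨exo.φ ⟨k, ⟨(l : ℕ) - 1, lt_of_le_of_lt (Nat.sub_le _ _) l.2⟩⟩,
          exo.basis_mem_scale α k _⟩) - Be P G (exo.φ ⟨k, l⟩)) ∈ (Ae P G).graph := by
  have hg := h.graph_block k (exo.φ ⟨k, l⟩)
  have e1 : (⟨exo.proj k (exo.φ ⟨k, l⟩), exo.proj_mem_scale α k _⟩ : exo.scale α) =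
      ⟨exo.φ ⟨k, l⟩, exo.basis_mem_scale α k l⟩ := Subtype.ext (exo.proj_basis k l)
  have e2 : Sig ⟨exo.block k (exo.φ ⟨k, l⟩), exo.block_mem_scale α k _⟩ =
      exo.freq k • Sig ⟨exo.φ ⟨k, l⟩, exo.basis_mem_scale α k l⟩ +
        (if (l : ℕ) = 0 then 0 else Sig ⟨exo.φ ⟨k, ⟨(l : ℕ) - 1, lt_of_le_of_lt (Nat.sub_le _ _) l.2⟩⟩,
          exo.basis_mem_scale α k _⟩) := by
    split_ifs with hl
    · rw [add_zero, ← map_smul]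
      congr 1
      ext
      simp [exo.block_basis, Exosystem.prev, hl]
    · rw [← map_smul, ← map_add]
      congr 1
      ext
      simp [exo.block_basis, Exosystem.prev, hl]
  rw [e1, e2, exo.proj_basis] at hg
  exact hg

/-- The nominal plant P₀ gives the algebra of (G₁, G₂) at iω_k, while P supplies Σ. The induction
also tracks that the Z-component of Σφ_k^j stays in the span of chain vectors of index at most j, so
that the next step can absorb it. -/
theorem IsSylvesterSolution.regErr_basis_of_hasPCopy [CompleteSpace W] [FiniteDimensional ℂ Y]
    {exo : Exosystem ι W} {α : ℝ} {P P₀ : Plant X U Y W} {G : Controller Z U Y}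
    {Sig : exo.scale α →ₗ[ℂ] X × Z} (h : IsSylvesterSolution exo α P G Sig)
    (hCe : RelBounded (Ce P G) (Ae P G)) (hA : ∀ k, exo.freq k ∈ resolventSet P₀.A)
    (hAe : ∀ k, exo.freq k ∈ resolventSet (Ae P₀ G)) (hG : HasPCopy exo G)
    (k : ι) (l : Fin (exo.n k)) :
    h.regErr hCe ⟨exo.φ ⟨k, l⟩, exo.basis_mem_scale _ k l⟩ = 0 := by
  obtain ⟨-, m, z, hm, hz, hind⟩ := hG k
  have key : ∀ {x : Z} {y : Y}, (x, exo.freq k • x - G.G₂ y) ∈ G.G₁.graph →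
      y = 0 ∧ x ∈ chainSpan z 0 :=
    fun hx => eq_zero_of_chains (hA k) (hAe k) (exo.n_pos k) hm hz hind hx
  let e : Fin (exo.n k) → Y := fun l => h.regErr hCe ⟨exo.φ ⟨k, l⟩, exo.basis_mem_scale _ k l⟩
  let ζ : Fin (exo.n k) → Z := fun l => (Sig ⟨exo.φ ⟨k, l⟩, exo.basis_mem_scale α k l⟩).2
  have hζ : ∀ l : Fin (exo.n k), (ζ l, exo.freq k • ζ l +
      (if (l : ℕ) = 0 then 0 else ζ ⟨(l : ℕ) - 1, lt_of_le_of_lt (Nat.sub_le _ _) l.2⟩) -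
        G.G₂ (e l)) ∈ G.G₁.graph := by
    intro l
    have hg := graph_Ae_snd (h.graph_basis k l)
      (hCe.mem_domain (h.mem_domain (exo.basis_mem_scale _ k l)))
    convert hg using 2
    simp only [e, h.regErr_apply, map_add, ζ]
    simp only [Prod.snd_sub, Prod.snd_add, Prod.smul_snd, Be]
    split_ifs <;> simp <;> abel
  suffices H : ∀ (j : ℕ) (hj : j < exo.n k), e ⟨j, hj⟩ = 0 ∧ ζ ⟨j, hj⟩ ∈ chainSpan z j from
    (H l l.2).1
  intro j
  induction j with
  | zero =>
    intro hj
    refine key ?_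
    simpa using hζ ⟨0, hj⟩
  | succ j ih =>
    intro hj
    -- Subtracting w removes ζ_j from the equation for ζ_{j+1}, which leaves (l − G₁)(ζ_{j+1} − w) =
    -- G₂e_{j+1}.
    obtain ⟨w, hw, hw'⟩ := exists_preimage_of_mem_chainSpan hm hz hj (ih (by omega)).2
    have h1 := G.G₁.graph.sub_mem (hζ ⟨j + 1, hj⟩) hw'
    have h2 := key (x := ζ ⟨j + 1, hj⟩ - w) (y := e ⟨j + 1, hj⟩) (by
      convert h1 using 1
      rw [Prod.mk_sub_mk]
      congr 1
      simp only [Nat.add_eq_zero_iff, one_ne_zero, and_false, if_false, Nat.add_sub_cancel]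
      module)
    refine ⟨h2.1, ?_⟩
    have h3 := Submodule.add_mem _ (chainSpan_mono z (Nat.zero_le (j + 1)) h2.2) hw
    rwa [sub_add_cancel] at h3

end InternalModel

section Necessity

variable {ι X U Y Z W : Type*}
  [NormedAddCommGroup X] [NormedSpace ℂ X] [NormedAddCommGroup U] [NormedSpace ℂ U]
  [NormedAddCommGroup Y] [NormedSpace ℂ Y] [NormedAddCommGroup Z] [NormedSpace ℂ Z]
  [NormedAddCommGroup W] [InnerProductSpace ℂ W]

/-! ### Necessity of the internal model -/

/-- The response `(-1)^j R(l, A_e)^{j+1} (0, G₂ y)` of the closed loop to a constant `y` added to the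
error in the first coordinate of a block at the frequency `l`. -/
def response (P : Plant X U Y W) (G : Controller Z U Y) (l : ℂ) : ℕ → Y →L[ℂ] X × Z
  | 0 => (resolvent (Ae P G) l).comp ((ContinuousLinearMap.inr ℂ X Z).comp G.G₂)
  | j + 1 => -(resolvent (Ae P G) l).comp (response P G l j)

/-- From A_e R = lR − 1: the forcing enters at j = 0, and the alternating sign makes each later
response a chain successor of the previous one. -/
theorem response_graph {P : Plant X U Y W} {G : Controller Z U Y} {l : ℂ}
    (hl : l ∈ resolventSet (Ae P G)) (j : ℕ) (y : Y) :
    (response P G l j y, l • response P G l j y +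
      (if j = 0 then 0 else response P G l (j - 1) y) - if j = 0 then (0, G.G₂ y) else 0) ∈
        (Ae P G).graph := by
  rcases j with _ | j
  · simpa [response] using (isResolvent_resolvent hl).mem_graph ((0 : X), G.G₂ y)
  · have h := (Ae P G).graph.neg_mem
      ((isResolvent_resolvent hl).mem_graph (response P G l j y))
    convert h using 1
    refine Prod.ext ?_ ?_
    · simp [response]
    · simp only [response, Nat.add_eq_zero_iff, one_ne_zero, and_false, if_false,
        Nat.add_sub_cancel, Prod.snd_neg, neg_apply,
        ContinuousLinearMap.comp_apply, sub_zero]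
      module

/-- The plant with the disturbance `⟨·, φ_k^0⟩ y` added to the reference signal. -/
def perturb (exo : Exosystem ι W) (P : Plant X U Y W) (k : ι) (y : Y) : Plant X U Y W :=
  { P with F := P.F + (innerSL ℂ (exo.φ ⟨k, ⟨0, exo.n_pos k⟩⟩)).smulRight y }

theorem perturb_F (exo : Exosystem ι W) (P : Plant X U Y W) (k : ι) (y : Y) (v : W) :
    (perturb exo P k y).F v = P.F v + exo.coeff k ⟨0, exo.n_pos k⟩ v • y := rfl

theorem Be_perturb (exo : Exosystem ι W) (P : Plant X U Y W) (G : Controller Z U Y) (k : ι)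
    (y : Y) (v : W) : Be (perturb exo P k y) G v =
      Be P G v + exo.coeff k ⟨0, exo.n_pos k⟩ v • ((0 : X), G.G₂ y) := by
  refine Prod.ext ?_ ?_
  · simp [Be, perturb]
  · simp only [Be, ContinuousLinearMap.prod_apply, ContinuousLinearMap.comp_apply, perturb_F,
      map_add, map_smul, Prod.snd_add, Prod.smul_snd]

/-- The solution of the Sylvester equation of the perturbed plant. -/
theorem IsSylvesterSolution.perturb [CompleteSpace W] {exo : Exosystem ι W} {α : ℝ} (hα : 0 ≤ α)
    {P : Plant X U Y W} {G : Controller Z U Y} {Sig : exo.scale α →ₗ[ℂ] X × Z}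
    (h : IsSylvesterSolution exo α P G Sig) {k : ι} (hk : exo.freq k ∈ resolventSet (Ae P G))
    (y : Y) : IsSylvesterSolution exo α (IMP.perturb exo P k y) G
      (Sig + exo.ofBlock k (fun j => response P G (exo.freq k) j y) ∘ₗ (exo.scale α).subtype) where
  bounded := by
    obtain ⟨M, hM⟩ := h.bounded
    refine ⟨M + ∑ j : Fin (exo.n k), ‖response P G (exo.freq k) j y‖, fun v => ?_⟩
    rw [LinearMap.add_apply, add_mul]
    refine (norm_add_le _ _).trans (add_le_add (hM v) ?_)
    refine (exo.norm_ofBlock_le k _ (v : W)).trans ?_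
    gcongr
    exact exo.norm_proj_le_scaleNorm hα v.2 k
  equation := by
    intro v hv
    obtain ⟨hS, hSα, hA, he⟩ := h.equation v hv
    set ψ : Fin (exo.n k) → X × Z := fun j => response P G (exo.freq k) j y with hψ
    have hprev : ∀ j : Fin (exo.n k), exo.ofBlock k ψ (exo.prev k j) =
        if (j : ℕ) = 0 then 0 else response P G (exo.freq k) ((j : ℕ) - 1) y := by
      intro j
      unfold Exosystem.prev
      split_ifs
      · simp
      · rw [exo.ofBlock_basis]
    have h1 : exo.ofBlock k ψ (exo.S ⟨v, hS⟩) = ∑ j, exo.coeff k j (v : W) •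
        (exo.freq k • ψ j +
          if (j : ℕ) = 0 then 0 else response P G (exo.freq k) ((j : ℕ) - 1) y) := by
      rw [← exo.ofBlock_proj_self, exo.proj_S, exo.block_eq_ofBlock, exo.map_ofBlock,
        exo.ofBlock_apply]
      simp only [map_add, map_smul, exo.ofBlock_basis, hprev]
    have h2 : exo.coeff k ⟨0, exo.n_pos k⟩ (v : W) • ((0 : X), G.G₂ y) =
        ∑ j : Fin (exo.n k), exo.coeff k j (v : W) •
          (if (j : ℕ) = 0 then ((0 : X), G.G₂ y) else 0) := by
      rw [Finset.sum_eq_single_of_mem ⟨0, exo.n_pos k⟩ (Finset.mem_univ _)]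
      · simp
      · intro j _ hj
        rw [if_neg fun h0 => hj (Fin.ext h0), smul_zero]
    have h3 : (exo.ofBlock k ψ (v : W), exo.ofBlock k ψ (exo.S ⟨v, hS⟩) -
        exo.coeff k ⟨0, exo.n_pos k⟩ (v : W) • ((0 : X), G.G₂ y)) ∈ (Ae P G).graph := by
      have := (Ae P G).graph.sum_mem fun (j : Fin (exo.n k)) (_ : j ∈ Finset.univ) =>
        (Ae P G).graph.smul_mem (exo.coeff k j (v : W)) (response_graph hk j y)
      convert this using 1
      rw [h1, h2, exo.ofBlock_apply]
      refine Prod.ext ?_ ?_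
      · simp only [Prod.fst_sum, Prod.smul_fst, hψ]
      · simp only [Prod.snd_sum, Prod.smul_snd, hψ, smul_sub, Finset.sum_sub_distrib]
    have h4 := (Ae P G).graph.add_mem ((Ae P G).mem_graph ⟨_, hA⟩) h3
    have hA' : Sig v + exo.ofBlock k ψ (v : W) ∈ (Ae P G).domain :=
      LinearPMap.mem_domain_of_mem_graph h4
    refine ⟨hS, hSα, hA', ?_⟩
    -- The perturbation alters F only, so A_e is definitionally the same operator.
    have h5 : Ae (IMP.perturb exo P k y) G ⟨Sig v + exo.ofBlock k ψ (v : W), hA'⟩ = _ :=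
      apply_of_mem_graph h4 hA'
    refine Eq.trans ?_ (congrArg (· + Be (IMP.perturb exo P k y) G v) h5.symm)
    rw [Be_perturb]
    change Sig ⟨exo.S ⟨v, hS⟩, hSα⟩ + exo.ofBlock k ψ (exo.S ⟨v, hS⟩) = _
    rw [he]
    change _ = Ae P G ⟨Sig v, hA⟩ + (_ - _) + _
    abel

theorem response_mem_domain {P : Plant X U Y W} {G : Controller Z U Y} {l : ℂ}
    (hl : l ∈ resolventSet (Ae P G)) (hCe : RelBounded (Ce P G) (Ae P G)) (j : ℕ) (y : Y) :
    response P G l j y ∈ (Ce P G).domain :=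
  hCe.mem_domain (LinearPMap.mem_domain_of_mem_graph (response_graph hl j y))

/-- Robust regulation determines the output of the closed loop for the constant disturbances. -/
theorem SolvesRORP.Ce_response [Countable ι] [CompleteSpace X] [CompleteSpace Z] [CompleteSpace W]
    {exo : Exosystem ι W} {α : ℝ} (hα : 0 ≤ α) {P : Plant X U Y W} {G : Controller Z U Y}
    (hR : SolvesRORP exo α P G) (hA : ∀ k, exo.freq k ∈ resolventSet P.A)
    (hCe : RelBounded (Ce P G) (Ae P G)) (hSyl : SylvesterSolvable exo α P G)
    {k : ι} (hk : exo.freq k ∈ resolventSet (Ae P G)) (j : Fin (exo.n k)) (y : Y) :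
    Ce P G ⟨response P G (exo.freq k) j y, response_mem_domain hk hCe j y⟩ =
      if (j : ℕ) = 0 then -y else 0 := by
  obtain ⟨Sig, hb, he⟩ := hSyl
  have h : IsSylvesterSolution exo α P G Sig := ⟨hb, he⟩
  have h' := h.perturb hα hk y
  obtain ⟨T, hT, -⟩ := hR.stable
  have hE := hR.robust (perturb exo P k y) ⟨hA, hR.stable, hCe, _, h'.bounded, h'.equation⟩
  have hCe' : RelBounded (Ce (perturb exo P k y) G) (Ae (perturb exo P k y) G) := hCe
  have hT' : Generates (Ae (perturb exo P k y) G) T := hT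
  -- Both error operators vanish at φ_k^j. Their difference there is C_e of the response, plus y
  -- when j = 0.
  have e1 := h.regErr_basis_eq_zero hCe hT hR.regulation k j
  have e2 := h'.regErr_basis_eq_zero hCe' hT' hE k j
  rw [IsSylvesterSolution.regErr_apply] at e1 e2
  have hd := hCe.mem_domain (h.mem_domain (exo.basis_mem_scale (α + 1) k j))
  have e3 : Ce P G (⟨Sig ⟨exo.φ ⟨k, j⟩, exo.basis_mem_scale α k j⟩, hd⟩ +
      ⟨response P G (exo.freq k) j y, response_mem_domain hk hCe j y⟩) +
        (P.F (exo.φ ⟨k, j⟩) + exo.coeff k ⟨0, exo.n_pos k⟩ (exo.φ ⟨k, j⟩) • y) = 0 := by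
    refine Eq.trans ?_ e2
    congr 1
    change _ = Ce P G _
    congr 1
    ext1
    exact congrArg (Sig ⟨exo.φ ⟨k, j⟩, exo.basis_mem_scale α k j⟩ + ·)
      (exo.ofBlock_basis k (fun j => response P G (exo.freq k) j y) j).symm
  rw [LinearPMap.map_add, exo.coeff_basis_self] at e3
  have e4 : Ce P G ⟨response P G (exo.freq k) j y, response_mem_domain hk hCe j y⟩ +
      (if (⟨0, exo.n_pos k⟩ : Fin (exo.n k)) = j then (1 : ℂ) else 0) • y = 0 := by
    rw [← e3]
    refine Eq.trans (zero_add _).symm ?_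
    rw [← e1]
    abel
  by_cases hj : (j : ℕ) = 0
  · rw [if_pos (Fin.ext hj.symm), one_smul] at e4
    rw [if_pos hj]
    exact eq_neg_of_add_eq_zero_left e4
  · rw [if_neg fun h0 => hj (congrArg Fin.val h0).symm, zero_smul, add_zero] at e4
    rw [if_neg hj, e4]

/-- Vectors of Jordan chains depending linearly on a parameter are independent if the first ones
are. -/
theorem eq_zero_of_sum_chain_eq_zero {A : Z →ₗ.[ℂ] Z} {l : ℂ} {ζ : ℕ → Y →ₗ[ℂ] Z} {n : ℕ}
    (h0 : ∀ y, ζ 0 y = 0 → y = 0)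
    (hζ : ∀ j < n, ∀ y, (ζ j y, l • ζ j y + if j = 0 then 0 else ζ (j - 1) y) ∈ A.graph)
    {y : ℕ → Y} (hy : ∑ j ∈ Finset.range n, ζ j (y j) = 0) : ∀ j < n, y j = 0 := by
  induction n generalizing y with
  | zero => intro j hj; omega
  | succ n ih =>
    have h1 := A.graph.sum_mem fun j (hj : j ∈ Finset.range (n + 1)) =>
      hζ j (Finset.mem_range.1 hj) (y j)
    -- Applying A − l kills the head and lowers all other indices, which gives a shorter relation
    -- with coefficients y (j + 1).
    have h2 : ∑ j ∈ Finset.range n, ζ j (y (j + 1)) = 0 := by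
      have h3 : (∑ j ∈ Finset.range (n + 1), ζ j (y j),
          l • ∑ j ∈ Finset.range (n + 1), ζ j (y j) + ∑ j ∈ Finset.range n, ζ j (y (j + 1))) ∈
          A.graph := by
        convert h1 using 1
        refine Prod.ext ?_ ?_
        · simp only [Prod.fst_sum]
        · simp only [Prod.snd_sum, Finset.sum_add_distrib, Finset.smul_sum]
          congr 1
          rw [Finset.sum_range_succ']
          simp
      rw [hy, smul_zero, zero_add] at h3
      exact LinearPMap.graph_fst_eq_zero_snd A h3 rfl
    have h4 := ih (fun j hj => hζ j (by omega)) h2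
    have h5 : ζ 0 (y 0) = 0 := by
      rw [Finset.sum_range_succ'] at hy
      rw [Finset.sum_eq_zero, zero_add] at hy
      · exact hy
      · intro j hj
        rw [h4 j (Finset.mem_range.1 hj), map_zero]
    intro j hj
    rcases j with _ | j
    · exact h0 _ h5
    · exact h4 j (by omega)

/-- The Z-components of the responses are the required chains: by `Ce_response` the output term in
the second row of A_e cancels the forcing G₂y. -/
theorem SolvesRORP.hasPCopy [Countable ι] [CompleteSpace X] [CompleteSpace Z] [CompleteSpace W]
    [FiniteDimensional ℂ Y]
    {exo : Exosystem ι W} {α : ℝ} (hα : 0 ≤ α) {P : Plant X U Y W} {G : Controller Z U Y}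
    (hR : SolvesRORP exo α P G) (hA : ∀ k, exo.freq k ∈ resolventSet P.A)
    (hCe : RelBounded (Ce P G) (Ae P G)) (hSyl : SylvesterSolvable exo α P G)
    (hAe : ∀ k, exo.freq k ∈ resolventSet (Ae P G)) : HasPCopy exo G := by
  intro k
  let ζ : ℕ → Y →ₗ[ℂ] Z := fun j =>
    LinearMap.snd ℂ X Z ∘ₗ (response P G (exo.freq k) j).toLinearMap
  have hζ : ∀ j < exo.n k, ∀ y, (ζ j y, exo.freq k • ζ j y +
      if j = 0 then 0 else ζ (j - 1) y) ∈ G.G₁.graph := by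
    intro j hj y
    have h1 := graph_Ae_snd (response_graph (hAe k) j y) (response_mem_domain (hAe k) hCe j y)
    rw [hR.Ce_response hα hA hCe hSyl (hAe k) ⟨j, hj⟩ y] at h1
    convert h1 using 1
    refine Prod.ext rfl ?_
    by_cases hj0 : j = 0 <;> simp [hj0, ζ]
  -- With zero controller state the first row is A₋₁x = iω_k x, so x = 0 and the whole response
  -- vanishes; yet its output is −y.
  have h0 : ∀ y, ζ 0 y = 0 → y = 0 := by
    intro y hy
    have h1 := graph_Ae_fst (response_graph (hAe k) 0 y) hy
    obtain ⟨T, hT⟩ := P.generates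
    have hx0 : (response P G (exo.freq k) 0 y).1 = 0 := by
      refine extrapOp_injective hT.dense_domain P.l₀_mem (hA k) (h1.trans ?_)
      rw [← map_smul]
      simp
    have h2 := hR.Ce_response hα hA hCe hSyl (hAe k) ⟨0, exo.n_pos k⟩ y
    have h3 : (⟨response P G (exo.freq k) 0 y, response_mem_domain (hAe k) hCe 0 y⟩ :
        (Ce P G).domain) = 0 := Subtype.ext (Prod.ext hx0 hy)
    rw [if_pos rfl] at h2
    rw [← neg_eq_zero, ← h2]
    exact (congrArg (Ce P G) h3).trans (LinearPMap.map_zero _)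
  let b := Module.finBasis ℂ Y
  have hdom : ∀ j < exo.n k, ∀ y, ζ j y ∈ G.G₁.domain := fun j hj y =>
    LinearPMap.mem_domain_of_mem_graph (hζ j hj y)
  refine ⟨?_, fun _ => exo.n k, fun i j => ζ j (b i), fun _ => le_rfl, fun i j => ?_, ?_⟩
  · have hmem : ∀ y, ζ 0 y ∈ eigenspace G.G₁ (exo.freq k) := by
      intro y
      refine ⟨⟨ζ 0 y, hdom 0 (exo.n_pos k) y⟩, ?_, rfl⟩
      have hg := hζ 0 (exo.n_pos k) y
      rw [if_pos rfl, add_zero] at hg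
      have := apply_of_mem_graph hg (hdom 0 (exo.n_pos k) y)
      rw [SetLike.mem_coe, LinearMap.mem_ker, LinearMap.sub_apply, sub_eq_zero]
      exact this.symm
    have hinj : Function.Injective ((ζ 0).codRestrict _ hmem) := by
      rw [injective_iff_map_eq_zero]
      intro y hy
      exact h0 y (congrArg Subtype.val hy)
    have h := LinearMap.lift_rank_le_of_injective _ hinj
    rw [← Module.finrank_eq_rank, Cardinal.lift_natCast] at h
    exact Cardinal.nat_le_lift_iff.1 h
  · refine ⟨hdom j j.2 (b i), ?_⟩
    rw [apply_of_mem_graph (hζ j j.2 (b i))]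
    simp
  · rw [Fintype.linearIndependent_iff]
    intro g hg
    -- Collect the coefficients at level j into one vector of Y, so that a relation among all chain
    -- vectors becomes ∑ ζ j (y j) = 0.
    let y : ℕ → Y := fun j => if hj : j < exo.n k then ∑ i, g ⟨i, ⟨j, hj⟩⟩ • b i else 0
    have hy : ∑ j ∈ Finset.range (exo.n k), ζ j (y j) = 0 := by
      rw [Finset.sum_range, ← hg, Fintype.sum_sigma, Finset.sum_comm]
      refine Finset.sum_congr rfl fun j _ => ?_
      simp [y]
    have hy0 := eq_zero_of_sum_chain_eq_zero h0 hζ hy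
    rintro ⟨i, j⟩
    have h1 := hy0 j j.2
    simp only [y, j.2, dite_true] at h1
    exact Fintype.linearIndependent_iff.1 b.linearIndependent _ h1 i

/-- A p-copy internal model achieves regulation for every admissible plant. -/
theorem HasPCopy.errorDecays [Countable ι] [CompleteSpace X] [CompleteSpace Z] [CompleteSpace W]
    [FiniteDimensional ℂ Y] {exo : Exosystem ι W} {α : ℝ} {P P₀ : Plant X U Y W}
    {G : Controller Z U Y} (hG : HasPCopy exo G) (hA : ∀ k, exo.freq k ∈ resolventSet P₀.A)
    (hAe : ∀ k, exo.freq k ∈ resolventSet (Ae P₀ G)) (hP : Admissible exo α G P) :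
    ErrorDecays exo α P G := by
  obtain ⟨Sig, hb, he⟩ := hP.sylvester
  have h : IsSylvesterSolution exo α P G Sig := ⟨hb, he⟩
  exact h.errorDecays hP.Ce_bounded hP.stable
    (h.regErr_eq_zero hP.Ce_bounded (h.regErr_basis_of_hasPCopy hP.Ce_bounded hA hAe hG))

end Necessity

end IMP

end

theorem mainTheorem1 {ι X U Y Z W : Type*} [Countable ι]
    [NormedAddCommGroup X] [NormedSpace ℂ X] [CompleteSpace X]
    [NormedAddCommGroup U] [NormedSpace ℂ U] [CompleteSpace U]
    [NormedAddCommGroup Y] [NormedSpace ℂ Y] [FiniteDimensional ℂ Y]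
    [NormedAddCommGroup Z] [NormedSpace ℂ Z] [CompleteSpace Z]
    [NormedAddCommGroup W] [InnerProductSpace ℂ W] [CompleteSpace W]
    (exo : IMP.Exosystem ι W) (α : ℝ) (hα : 0 ≤ α)
    (P : IMP.Plant X U Y W) (G : IMP.Controller Z U Y)
    (hA : ∀ k, exo.freq k ∈ IMP.resolventSet P.A)
    (hstab : IMP.GeneratesStronglyStable (IMP.Ae P G))
    (hCe : IMP.RelBounded (IMP.Ce P G) (IMP.Ae P G))
    (hAe : ∀ k, exo.freq k ∈ IMP.resolventSet (IMP.Ae P G))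
    (hSyl : IMP.SylvesterSolvable exo α P G) :
    IMP.SolvesRORP exo α P G ↔ IMP.HasPCopy exo G :=
  ⟨fun hR => hR.hasPCopy hα hA hCe hSyl hAe, fun hG =>
    -- The nominal plant is itself admissible, so one lemma covers both regulation and robustness.
    ⟨hstab, hG.errorDecays hA hAe ⟨hA, hstab, hCe, hSyl⟩, fun _ hP' => hG.errorDecays hA hAe hP'⟩⟩
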